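/- Let $G$ be a compact Lie group and let $\tau$ be a nontrivial (continuous, finite-dimensional, complex) irreducible representation of $G$ whose character $\chi^\tau$ is real valued. Let $\alpha\in G$, $\alpha\neq 1$, be conjugate to $\alpha^{-1}$, put $a=1-\frac{\chi^{\tau}(\alpha)}{\dim\tau}$, and assume $a\neq 0$. For an irreducible representation $\phi$ of $G$ let $\chi^\phi$ be its character and $m_\phi(\tau^2)$ its multiplicity in $\tau\otimes\tau$. Let $W=\chi^\tau(g)$, where $g$ is distributed according to the normalized Haar measure of $G$. Then the numbers $\chi^\phi(\alpha)$ are real, only finitely many $m_\phi(\tau^2)$ are nonzero, the second sum below is nonnegative, and for all real $x_0$, $$\left|\mathbb P(W\le x_0)-\frac1{\sqrt{2\pi}}\int_{-\infty}^{x_0}e^{-x^2/2}\,dx\right|\le\sqrt{\sum_{\phi}{}^{*}\,m_\phi(\tau^2)^2\left[2-\frac1a\left(1-\frac{\chi^\phi(\alpha)}{\dim\phi}\right)\right]^2}+\left[\frac1\pi\sum_\phi m_\phi(\tau^2)^2\left(8-\frac6a\left(1-\frac{\chi^\phi(\alpha)}{\dim\phi}\right)\right)\right]^{1/4}.$$ Here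 the second sum is over all isomorphism classes of irreducible representations $\phi$ of $G$, and the first sum is over all nontrivial ones. -/

import Mathlib

open MeasureTheory Set
open scoped ContDiff

noncomputable section

namespace CompactLieCLT

/-- A representation of a topological group on a finite-dimensional complex vector space is
continuous if all its matrix coefficients are continuous functions on the group. -/
def IsContinuousRep {G V : Type*} [Group G] [TopologicalSpace G] [AddCommGroup V] [Module ℂ V]
    (ρ : Representation ℂ G V) : Prop :=
  ∀ (v : V) (l : Module.Dual ℂ V), Continuous fun g : G => l (ρ g v)

/-- A continuous irreducible complex representation of `G` on a standard space `ℂⁿ`; every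
finite-dimensional continuous irreducible representation is isomorphic to one of these. -/
structure Irrep (G : Type*) [Group G] [TopologicalSpace G] where
  /-- the dimension -/
  n : ℕ
  /-- the representation -/
  rep : Representation ℂ G (Fin n → ℂ)
  continuous_rep : IsContinuousRep rep
  irreducible_rep : rep.IsIrreducible

/-- Isomorphism of representations. -/
instance irrepSetoid (G : Type*) [Group G] [TopologicalSpace G] : Setoid (Irrep G) where
  r φ ψ := Nonempty (φ.rep.Equiv ψ.rep)
  iseqv :=
    { refl := fun φ => ⟨Representation.Equiv.refl φ.rep⟩
      symm := fun ⟨e⟩ => ⟨e.symm⟩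
      trans := fun ⟨e⟩ ⟨f⟩ => ⟨e.trans f⟩ }

/-- The isomorphism classes of irreducible representations of `G`. -/
def IrrepClass (G : Type*) [Group G] [TopologicalSpace G] : Type _ :=
  Quotient (irrepSetoid G)

namespace IrrepClass

variable {G : Type*} [Group G] [TopologicalSpace G]

/-- A representative of an isomorphism class. Everything defined from it below (dimension,
character, multiplicity, triviality) is invariant under isomorphism. -/
def out (φ : IrrepClass G) : Irrep G := Quotient.out φ

/-- `dim φ`. -/
def dim (φ : IrrepClass G) : ℕ := φ.out.n

/-- The character `χ^φ`. -/
def character (φ : IrrepClass G) (g : G) : ℂ := φ.out.rep.character g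

/-- `φ` is the trivial representation. -/
def IsTrivial (φ : IrrepClass G) : Prop := φ.out.rep.IsTrivial

/-- The multiplicity of `φ` in a finite-dimensional representation `σ`:
the dimension of the space of intertwining maps from `φ` to `σ`. -/
def mult (φ : IrrepClass G) {V : Type*} [AddCommGroup V] [Module ℂ V]
    (σ : Representation ℂ G V) : ℕ :=
  Module.finrank ℂ (Representation.IntertwiningMap φ.out.rep σ)

end IrrepClass

end CompactLieCLT

end

/-!
Let `W g = χ^τ(g)` and `W' (g, h) = χ^τ(h α h⁻¹ g)`, where `g` and `h` are independent and Haar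
distributed. As `α` is conjugate to its inverse, `(W, W')` is exchangeable, and Schur's lemma gives
`E[W' | g] = (1 - a) W`. Stein's method bounds the distance from `W` to a Gaussian by the
fluctuations of `E[(W' - W)² | g]` and by `E|W' - W|³`, the latter being at most
`(E(W' - W)² E(W' - W)⁴)^(1/2)` by the Cauchy-Schwarz inequality.

Now `W² = χ^(τ²) = ∑ m_φ(τ²) χ^φ`, and averaging `χ^φ(h α h⁻¹ g)` over `h` multiplies `χ^φ(g)` by
`χ^φ(α) / dim φ`. So `E[(W' - W)² | g]` is an explicit combination of irreducible characters, and
`E(W' - W)⁴` is an explicit combination of `E W⁴` and `E W² W'²`: both terms of the bound are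
computed by orthonormality of the characters.
-/

noncomputable section

namespace CompactLieCLT

open ProbabilityTheory
open scoped NNReal

/-! ### Stein's equation for the standard Gaussian -/

section Gaussian

local notation "γ" => gaussianReal 0 1
local notation "ϕ" => gaussianPDFReal 0 1

theorem gaussianPDFReal_std (x : ℝ) : ϕ x = (√(2 * Real.pi))⁻¹ * Real.exp (-x ^ 2 / 2) := by
  simp [gaussianPDFReal]

theorem gaussianPDFReal_std_pos (x : ℝ) : 0 < ϕ x := gaussianPDFReal_pos 0 1 x one_ne_zero

theorem gaussianPDFReal_std_le (x : ℝ) : ϕ x ≤ (√(2 * Real.pi))⁻¹ := by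
  rw [gaussianPDFReal_std]
  exact mul_le_of_le_one_right (by positivity) (Real.exp_le_one_iff.2 (by nlinarith [sq_nonneg x]))

theorem hasDerivAt_gaussianPDFReal_std (x : ℝ) : HasDerivAt ϕ (-x * ϕ x) x := by
  have h := (((hasDerivAt_id x).pow 2).neg.div_const 2).exp.const_mul (√(2 * Real.pi))⁻¹
  rw [funext gaussianPDFReal_std]
  refine h.congr_deriv ?_
  simp only [Pi.neg_apply, Pi.pow_apply, id_eq, Nat.cast_ofNat, Nat.add_one_sub_one, pow_one,
    mul_one]
  ring

theorem continuous_gaussianPDFReal_std : Continuous ϕ :=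
  continuous_iff_continuousAt.2 fun x => (hasDerivAt_gaussianPDFReal_std x).continuousAt

theorem setIntegral_gaussianReal_std (f : ℝ → ℝ) (s : Set ℝ) :
    ∫ x in s, f x ∂γ = ∫ x in s, f x * ϕ x := by
  rw [gaussianReal_of_var_ne_zero _ one_ne_zero, setIntegral_withDensity_eq_setIntegral_toReal_smul'
    s (measurable_gaussianPDF 0 1) (.of_forall fun _ => gaussianPDF_lt_top)]
  simp only [toReal_gaussianPDF, smul_eq_mul, mul_comm]

theorem integrable_gaussianReal_std_iff {f : ℝ → ℝ} :
    Integrable f γ ↔ Integrable fun x => f x * ϕ x := by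
  rw [gaussianReal_of_var_ne_zero _ one_ne_zero, integrable_withDensity_iff
    (measurable_gaussianPDF 0 1) (.of_forall fun _ => gaussianPDF_lt_top)]
  simp only [toReal_gaussianPDF]

theorem measureReal_gaussianReal_std_Iic (w : ℝ) :
    (γ).real (Iic w) = 1 / √(2 * Real.pi) * ∫ x in Iic w, Real.exp (-x ^ 2 / 2) := by
  rw [← mul_one ((γ).real (Iic w)), ← smul_eq_mul, ← setIntegral_const,
    setIntegral_gaussianReal_std]
  simp only [one_mul, gaussianPDFReal_std, integral_const_mul, one_div]

theorem measureReal_Iic_add_Ioi {P : Measure ℝ} [IsProbabilityMeasure P] (w : ℝ) :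
    P.real (Iic w) + P.real (Ioi w) = 1 := by
  rw [← compl_Iic, probReal_add_probReal_compl measurableSet_Iic]

theorem integrable_pow_gaussianReal_std (n : ℕ) : Integrable (fun z : ℝ => z ^ n) γ := by
  have := (memLp_id_gaussianReal (μ := 0) (v := 1) n).integrable_norm_pow'
  refine (integrable_norm_iff (by fun_prop)).1 (this.congr (.of_forall fun z => ?_))
  simp

theorem integrable_id_gaussianReal_std : Integrable (fun z : ℝ => z) γ := by
  simpa using integrable_pow_gaussianReal_std 1

section Improper

variable {f f' : ℝ → ℝ} (hf : ∀ x, HasDerivAt f (f' x) x) (hi : Integrable f γ)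
  (hi' : Integrable (fun z => f' z - z * f z) γ) (w : ℝ)

include hf hi hi'

theorem setIntegral_Iic_stein : ∫ z in Iic w, (f' z - z * f z) ∂γ = f w * ϕ w := by
  have h (x : ℝ) : HasDerivAt (fun x => f x * ϕ x) ((f' x - x * f x) * ϕ x) x :=
    ((hf x).mul (hasDerivAt_gaussianPDFReal_std x)).congr_deriv (by ring)
  have hi := (integrable_gaussianReal_std_iff.1 hi).integrableOn (s := Iic w)
  have hi' := (integrable_gaussianReal_std_iff.1 hi').integrableOn (s := Iic w)
  rw [setIntegral_gaussianReal_std, integral_Iic_of_hasDerivAt_of_tendsto' (fun x _ => h x) hi'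
    (tendsto_zero_of_hasDerivAt_of_integrableOn_Iic (fun x _ => h x) hi' hi), sub_zero]

theorem setIntegral_Ioi_stein : ∫ z in Ioi w, (f' z - z * f z) ∂γ = -(f w * ϕ w) := by
  have h (x : ℝ) : HasDerivAt (fun x => f x * ϕ x) ((f' x - x * f x) * ϕ x) x :=
    ((hf x).mul (hasDerivAt_gaussianPDFReal_std x)).congr_deriv (by ring)
  have hi := (integrable_gaussianReal_std_iff.1 hi).integrableOn (s := Ioi w)
  have hi' := (integrable_gaussianReal_std_iff.1 hi').integrableOn (s := Ioi w)
  rw [setIntegral_gaussianReal_std, integral_Ioi_of_hasDerivAt_of_tendsto' (fun x _ => h x) hi'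
    (tendsto_zero_of_hasDerivAt_of_integrableOn_Ioi (fun x _ => h x) hi' hi), zero_sub]

end Improper

theorem setIntegral_Ioi_sub_gaussianReal_std (w : ℝ) :
    ∫ z in Ioi w, (z - w) ∂γ = ϕ w - w * (γ).real (Ioi w) := by
  have h := setIntegral_Ioi_stein (fun x => hasDerivAt_const x (-1 : ℝ)) (integrable_const _)
    (by simpa using integrable_id_gaussianReal_std) w
  simp only [zero_sub, mul_neg, mul_one, neg_neg, neg_mul, one_mul] at h
  rw [integral_sub integrable_id_gaussianReal_std.integrableOn (integrable_const w), h,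
    setIntegral_const, smul_eq_mul, mul_comm]

theorem setIntegral_Iic_sub_gaussianReal_std (w : ℝ) :
    ∫ z in Iic w, (w - z) ∂γ = w * (γ).real (Iic w) + ϕ w := by
  have h := setIntegral_Iic_stein (fun x => hasDerivAt_const x (-1 : ℝ)) (integrable_const _)
    (by simpa using integrable_id_gaussianReal_std) w
  simp only [zero_sub, mul_neg, mul_one, neg_neg, neg_mul, one_mul] at h
  rw [integral_sub (integrable_const w) integrable_id_gaussianReal_std.integrableOn, h,
    setIntegral_const, smul_eq_mul, mul_comm, sub_neg_eq_add]

theorem hasDerivAt_two_mul_sub (w x : ℝ) : HasDerivAt (fun x => 2 * w - x) (-1) x := by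
  simpa using (hasDerivAt_id x).const_sub (2 * w)

theorem integrable_stein_two_mul_sub (w : ℝ) :
    Integrable (fun z : ℝ => -1 - z * (2 * w - z)) γ := by
  refine (((integrable_pow_gaussianReal_std 2).sub
    (integrable_id_gaussianReal_std.const_mul (2 * w))).sub (integrable_const 1)).congr
    (.of_forall fun z => ?_)
  simp only [Pi.sub_apply]
  ring

theorem sq_sub_eq_stein_two_mul_sub (w z : ℝ) :
    (z - w) ^ 2 = -1 - z * (2 * w - z) + (1 + w ^ 2) := by
  ring

theorem setIntegral_Ioi_sq_sub_gaussianReal_std (w : ℝ) :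
    ∫ z in Ioi w, (z - w) ^ 2 ∂γ = (1 + w ^ 2) * (γ).real (Ioi w) - w * ϕ w := by
  simp only [sq_sub_eq_stein_two_mul_sub]
  rw [integral_add (integrable_stein_two_mul_sub w).integrableOn (integrable_const _),
    setIntegral_Ioi_stein (hasDerivAt_two_mul_sub w)
    ((integrable_const _).sub integrable_id_gaussianReal_std) (integrable_stein_two_mul_sub w) w,
    setIntegral_const, smul_eq_mul]
  ring

theorem setIntegral_Iic_sq_sub_gaussianReal_std (w : ℝ) :
    ∫ z in Iic w, (z - w) ^ 2 ∂γ = (1 + w ^ 2) * (γ).real (Iic w) + w * ϕ w := by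
  simp only [sq_sub_eq_stein_two_mul_sub]
  rw [integral_add (integrable_stein_two_mul_sub w).integrableOn (integrable_const _),
    setIntegral_Iic_stein (hasDerivAt_two_mul_sub w)
    ((integrable_const _).sub integrable_id_gaussianReal_std) (integrable_stein_two_mul_sub w) w,
    setIntegral_const, smul_eq_mul]
  ring

theorem memLp_comp_of_lipschitzWith {Ω : Type*} [MeasurableSpace Ω] {P : Measure Ω}
    [IsFiniteMeasure P] {p : ENNReal} {K : ℝ≥0} {g : ℝ → ℝ} {X : Ω → ℝ}
    (hg : LipschitzWith K g) (hX : MemLp X p P) : MemLp (fun ξ => g (X ξ)) p P := by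
  have h : LipschitzWith K fun x => g x - g 0 :=
    .of_dist_le_mul fun x y => by simpa using hg.dist_le_mul x y
  refine ((h.comp_memLp (sub_self _) hX).add (memLp_const (g 0))).ae_eq (.of_forall fun ξ => ?_)
  simp

theorem hasDerivAt_setIntegral_Iic_gaussianReal_std {f : ℝ → ℝ} (hf : Continuous f)
    (hi : Integrable f γ) (w : ℝ) :
    HasDerivAt (fun x => ∫ z in Iic x, f z ∂γ) (f w * ϕ w) w := by
  have hi := integrable_gaussianReal_std_iff.1 hi
  have h : (fun x => ∫ z in Iic x, f z ∂γ) =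
      fun x => (∫ z in Iic w, f z * ϕ z) + ∫ z in w..x, f z * ϕ z := by
    ext x
    rw [← intervalIntegral.integral_Iic_sub_Iic hi.integrableOn hi.integrableOn,
      setIntegral_gaussianReal_std]
    ring
  rw [h]
  exact (((hf.mul continuous_gaussianPDFReal_std).integral_hasStrictDerivAt w w).hasDerivAt)
    |>.const_add _

/-- The solution of Stein's equation `f' w - w * f w = h w - ∫ h dγ`, where `γ` is the standard
normal distribution, which is bounded for bounded `h`. -/
def steinSolution (h : ℝ → ℝ) (w : ℝ) : ℝ := (∫ z in Iic w, (h z - ∫ x, h x ∂γ) ∂γ) / ϕ w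

section SteinSolution

variable {h : ℝ → ℝ} {L : ℝ≥0} (hL : LipschitzWith L h) (h01 : ∀ x, h x ∈ Icc 0 1)

include hL

theorem integrable_gaussianReal_std_of_lipschitzWith : Integrable h γ :=
  memLp_one_iff_integrable.1 (memLp_comp_of_lipschitzWith hL (memLp_id_gaussianReal 1))

theorem hasDerivAt_steinSolution (w : ℝ) :
    HasDerivAt (steinSolution h) (h w - ∫ x, h x ∂γ + w * steinSolution h w) w := by
  have hϕ := (gaussianPDFReal_std_pos w).ne'
  have hF := hasDerivAt_setIntegral_Iic_gaussianReal_std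
    (f := fun z => h z - ∫ x, h x ∂γ) (hL.continuous.sub continuous_const)
    ((integrable_gaussianReal_std_of_lipschitzWith hL).sub (integrable_const _)) w
  refine (hF.div (hasDerivAt_gaussianPDFReal_std w) hϕ).congr_deriv ?_
  rw [steinSolution]
  field_simp
  ring

theorem differentiable_steinSolution : Differentiable ℝ (steinSolution h) :=
  fun w => (hasDerivAt_steinSolution hL w).differentiableAt

theorem setIntegral_Ioi_sub_integral_gaussianReal_std (w : ℝ) :
    ∫ z in Ioi w, (h z - ∫ x, h x ∂γ) ∂γ = -(steinSolution h w * ϕ w) := by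
  have hi := integrable_gaussianReal_std_of_lipschitzWith hL
  have h := integral_add_compl (measurableSet_Iic (a := w))
    (hi.sub (integrable_const (∫ x, h x ∂γ)))
  simp only [Pi.sub_apply, compl_Iic] at h
  rw [integral_sub hi (integrable_const _), integral_const, probReal_univ, one_smul, sub_self] at h
  rw [steinSolution, div_mul_cancel₀ _ (gaussianPDFReal_std_pos w).ne']
  linarith

theorem abs_setIntegral_Iic_sub_le (w : ℝ) :
    |∫ z in Iic w, (h z - h w) ∂γ| ≤ L * (w * (γ).real (Iic w) + ϕ w) := by
  rw [← setIntegral_Iic_sub_gaussianReal_std, ← integral_const_mul]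
  refine norm_integral_le_of_norm_le (f := fun z => h z - h w) (g := fun z => L * (w - z))
    (((integrable_const w).sub integrable_id_gaussianReal_std).const_mul _).integrableOn
    ((ae_restrict_mem measurableSet_Iic).mono fun z hz => (hL.dist_le_mul z w).trans_eq ?_)
  rw [dist_comm, Real.dist_eq, abs_of_nonneg (sub_nonneg.2 hz)]

theorem abs_setIntegral_Ioi_sub_le (w : ℝ) :
    |∫ z in Ioi w, (h w - h z) ∂γ| ≤ L * (ϕ w - w * (γ).real (Ioi w)) := by
  rw [← setIntegral_Ioi_sub_gaussianReal_std, ← integral_const_mul]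
  refine norm_integral_le_of_norm_le (f := fun z => h w - h z) (g := fun z => L * (z - w))
    ((integrable_id_gaussianReal_std.sub (integrable_const w)).const_mul _).integrableOn
    ((ae_restrict_mem measurableSet_Ioi).mono fun z hz => (hL.dist_le_mul w z).trans_eq ?_)
  rw [dist_comm, Real.dist_eq, abs_of_pos (sub_pos.2 hz)]

theorem sub_integral_eq_setIntegral_sub (w : ℝ) :
    h w - ∫ x, h x ∂γ = (∫ z in Ioi w, (h w - h z) ∂γ) - ∫ z in Iic w, (h z - h w) ∂γ := by
  have hi := integrable_gaussianReal_std_of_lipschitzWith hL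
  have hPQ := measureReal_Iic_add_Ioi (P := γ) w
  rw [← integral_add_compl (measurableSet_Iic (a := w)) hi, compl_Iic,
    integral_sub hi.integrableOn (integrable_const _), setIntegral_const,
    integral_sub (integrable_const _) hi.integrableOn, setIntegral_const, smul_eq_mul, smul_eq_mul]
  linear_combination (-h w) * hPQ

theorem steinSolution_mul_gaussianPDFReal (w : ℝ) :
    steinSolution h w * ϕ w = (γ).real (Ioi w) * (∫ z in Iic w, (h z - h w) ∂γ) +
      (γ).real (Iic w) * ∫ z in Ioi w, (h w - h z) ∂γ := by
  have hi := integrable_gaussianReal_std_of_lipschitzWith hL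
  have hc := sub_integral_eq_setIntegral_sub hL w
  have hPQ := measureReal_Iic_add_Ioi (P := γ) w
  have hsplit : ∫ z in Iic w, (h z - ∫ x, h x ∂γ) ∂γ =
      (∫ z in Iic w, (h z - h w) ∂γ) + (γ).real (Iic w) * (h w - ∫ x, h x ∂γ) := by
    rw [integral_sub hi.integrableOn (integrable_const _),
      integral_sub hi.integrableOn (integrable_const _)]
    simp only [setIntegral_const, smul_eq_mul]
    ring
  rw [steinSolution, div_mul_cancel₀ _ (gaussianPDFReal_std_pos w).ne', hsplit, hc]
  linear_combination (-∫ z in Iic w, (h z - h w) ∂γ) * hPQ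

theorem abs_deriv_id_mul_steinSolution_le (w : ℝ) :
    |steinSolution h w + w * (h w - ∫ x, h x ∂γ + w * steinSolution h w)| ≤ L := by
  have hϕ := gaussianPDFReal_std_pos w
  have hPQ := measureReal_Iic_add_Ioi (P := γ) w
  have hA := abs_setIntegral_Iic_sub_le hL w
  have hB := abs_setIntegral_Ioi_sub_le hL w
  have hc := sub_integral_eq_setIntegral_sub hL w
  have hS := eq_div_of_mul_eq hϕ.ne' (steinSolution_mul_gaussianPDFReal hL w)
  set A := ∫ z in Iic w, (h z - h w) ∂γ
  set B := ∫ z in Ioi w, (h w - h z) ∂γ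
  let a := (∫ z in Ioi w, (z - w) ^ 2 ∂γ) / ϕ w
  let b := (∫ z in Iic w, (z - w) ^ 2 ∂γ) / ϕ w
  have ha : 0 ≤ a := div_nonneg (integral_nonneg fun _ => sq_nonneg _) hϕ.le
  have hb : 0 ≤ b := div_nonneg (integral_nonneg fun _ => sq_nonneg _) hϕ.le
  have hQ : (γ).real (Ioi w) = 1 - (γ).real (Iic w) := by linarith
  calc |steinSolution h w + w * (h w - ∫ x, h x ∂γ + w * steinSolution h w)|
      = |a * A + b * B| := by
        simp only [a, b, setIntegral_Ioi_sq_sub_gaussianReal_std,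
          setIntegral_Iic_sq_sub_gaussianReal_std, hc, hS]
        field_simp
        ring_nf
    _ ≤ a * |A| + b * |B| := by
        simpa only [abs_mul, abs_of_nonneg ha, abs_of_nonneg hb] using abs_add_le (a * A) (b * B)
    _ ≤ a * (L * (w * (γ).real (Iic w) + ϕ w)) + b * (L * (ϕ w - w * (γ).real (Ioi w))) := by
        gcongr
    _ = L := by
        simp only [a, b, setIntegral_Ioi_sq_sub_gaussianReal_std,
          setIntegral_Iic_sq_sub_gaussianReal_std, hQ]
        field_simp
        ring

theorem lipschitzWith_deriv_steinSolution : LipschitzWith (2 * L) (deriv (steinSolution h)) := by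
  have hder (w : ℝ) := hasDerivAt_steinSolution hL w
  have hmul : LipschitzWith L fun w => w * steinSolution h w :=
    lipschitzWith_of_nnnorm_deriv_le (fun w => ((hasDerivAt_id' w).mul (hder w)).differentiableAt)
      fun w => by
        rw [← NNReal.coe_le_coe, ((hasDerivAt_id' w).fun_mul (hder w)).deriv]
        simpa using abs_deriv_id_mul_steinSolution_le hL w
  have hsum := (hL.sub (.const (∫ x, h x ∂γ))).add hmul
  rwa [add_zero, ← two_mul, ← funext fun w => (hder w).deriv] at hsum

include h01

theorem abs_sub_integral_gaussianReal_std_le_one (w : ℝ) : |h w - ∫ x, h x ∂γ| ≤ 1 := by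
  have hi := integrable_gaussianReal_std_of_lipschitzWith hL
  have hc0 : 0 ≤ ∫ x, h x ∂γ := integral_nonneg fun x => (h01 x).1
  have hc1 : ∫ x, h x ∂γ ≤ 1 := by
    simpa using integral_mono hi (integrable_const 1) fun x => (h01 x).2
  exact abs_le.2 ⟨by linarith [(h01 w).1], by linarith [(h01 w).2]⟩

theorem abs_setIntegral_sub_integral_le (s : Set ℝ) :
    |∫ z in s, (h z - ∫ x, h x ∂γ) ∂γ| ≤ (γ).real s := by
  simpa using norm_setIntegral_le_of_norm_le_const (f := fun z => h z - ∫ x, h x ∂γ)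
    (measure_lt_top γ s) fun z _ => abs_sub_integral_gaussianReal_std_le_one hL h01 z

theorem abs_mul_steinSolution_le_one (w : ℝ) : |w * steinSolution h w| ≤ 1 := by
  have hϕ := gaussianPDFReal_std_pos w
  rw [← mul_div_cancel_right₀ (steinSolution h w) hϕ.ne', ← mul_div_assoc, abs_div, abs_of_pos hϕ,
    div_le_one hϕ, abs_mul]
  rcases le_total 0 w with hw | hw
  · have hnonneg : 0 ≤ ∫ z in Ioi w, (z - w) ∂γ :=
      setIntegral_nonneg measurableSet_Ioi fun z hz => sub_nonneg.2 (le_of_lt hz)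
    rw [setIntegral_Ioi_sub_gaussianReal_std] at hnonneg
    rw [← abs_neg (steinSolution h w * ϕ w), ← setIntegral_Ioi_sub_integral_gaussianReal_std hL,
      abs_of_nonneg hw]
    linarith [mul_le_mul_of_nonneg_left (abs_setIntegral_sub_integral_le hL h01 (Ioi w)) hw]
  · have hnonneg : 0 ≤ ∫ z in Iic w, (w - z) ∂γ :=
      setIntegral_nonneg measurableSet_Iic fun z hz => sub_nonneg.2 hz
    rw [setIntegral_Iic_sub_gaussianReal_std] at hnonneg
    rw [steinSolution, div_mul_cancel₀ _ hϕ.ne', abs_of_nonpos hw]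
    linarith [mul_le_mul_of_nonneg_left (abs_setIntegral_sub_integral_le hL h01 (Iic w))
      (neg_nonneg.2 hw)]

theorem abs_deriv_steinSolution_le_two (w : ℝ) : |deriv (steinSolution h) w| ≤ 2 := by
  rw [(hasDerivAt_steinSolution hL w).deriv]
  linarith [abs_add_le (h w - ∫ x, h x ∂γ) (w * steinSolution h w),
    abs_sub_integral_gaussianReal_std_le_one hL h01 w, abs_mul_steinSolution_le_one hL h01 w]

theorem lipschitzWith_steinSolution : LipschitzWith 2 (steinSolution h) :=
  lipschitzWith_of_nnnorm_deriv_le (differentiable_steinSolution hL)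
    (abs_deriv_steinSolution_le_two hL h01)

end SteinSolution

theorem abs_sub_sub_mul_deriv_le {f : ℝ → ℝ} {K : ℝ≥0} (hf : Differentiable ℝ f)
    (hK : LipschitzWith K (deriv f)) (x y : ℝ) :
    |f y - f x - (y - x) * deriv f x| ≤ K / 2 * (y - x) ^ 2 := by
  have hu (s : ℝ) : HasDerivAt (fun s : ℝ => f (x + s * (y - x)) - s * ((y - x) * deriv f x))
      ((deriv f (x + s * (y - x)) - deriv f x) * (y - x)) s := by
    have hline : HasDerivAt (fun s : ℝ => x + s * (y - x)) (1 * (y - x)) s :=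
      ((hasDerivAt_id' s).mul_const (y - x)).const_add x
    refine (((hf _).hasDerivAt.comp s hline).sub
      ((hasDerivAt_id' s).mul_const ((y - x) * deriv f x))).congr_deriv ?_
    ring
  have hcont : Continuous fun s : ℝ => (deriv f (x + s * (y - x)) - deriv f x) * (y - x) :=
    ((hK.continuous.comp (by fun_prop)).sub continuous_const).mul continuous_const
  have hFTC := intervalIntegral.integral_eq_sub_of_hasDerivAt (fun s _ => hu s)
    (hcont.intervalIntegrable 0 1)
  have hle (s : ℝ) (hs : s ∈ Ioc (0 : ℝ) 1) :
      ‖(deriv f (x + s * (y - x)) - deriv f x) * (y - x)‖ ≤ K * (y - x) ^ 2 * s := by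
    have h := hK.dist_le_mul (x + s * (y - x)) x
    rw [Real.dist_eq, Real.dist_eq, add_sub_cancel_left, abs_mul, abs_of_pos hs.1] at h
    rw [norm_mul, Real.norm_eq_abs, Real.norm_eq_abs, ← sq_abs (y - x)]
    nlinarith [abs_nonneg (y - x)]
  calc |f y - f x - (y - x) * deriv f x|
      = ‖∫ s in (0 : ℝ)..1, (deriv f (x + s * (y - x)) - deriv f x) * (y - x)‖ := by
        rw [hFTC, Real.norm_eq_abs]
        ring_nf
    _ ≤ ∫ s in (0 : ℝ)..1, K * (y - x) ^ 2 * s :=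
        intervalIntegral.norm_integral_le_of_norm_le zero_le_one (.of_forall hle)
          (Continuous.intervalIntegrable (by fun_prop) _ _)
    _ = K / 2 * (y - x) ^ 2 := by
        rw [intervalIntegral.integral_const_mul, integral_id]
        ring

/-- The continuous piecewise linear function equal to `1` up to `t` and to `0` from `t + δ` on,
used to smooth the indicator function of a half-line. -/
def ramp (t δ x : ℝ) : ℝ := max 0 (min 1 (1 - (x - t) / δ))

theorem ramp_mem_Icc (t δ x : ℝ) : ramp t δ x ∈ Icc 0 1 :=
  ⟨le_max_left _ _, max_le zero_le_one (min_le_left _ _)⟩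

section Ramp

variable {δ : ℝ} (hδ : 0 < δ) (t : ℝ)

include hδ

theorem ramp_of_le {t x : ℝ} (h : x ≤ t) : ramp t δ x = 1 := by
  have : (x - t) / δ ≤ 0 := div_nonpos_of_nonpos_of_nonneg (by linarith) hδ.le
  rw [ramp, min_eq_left (by linarith), max_eq_right zero_le_one]

theorem one_sub_ramp (x : ℝ) : 1 - ramp t δ x = ramp (-(t + δ)) δ (-x) := by
  have hu : 1 - (-x - -(t + δ)) / δ = 1 - (1 - (x - t) / δ) := by
    field_simp
    ring
  rw [ramp, ramp, hu]
  grind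

theorem ramp_of_ge {t x : ℝ} (h : t + δ ≤ x) : ramp t δ x = 0 := by
  have := one_sub_ramp hδ t x
  rw [ramp_of_le hδ (neg_le_neg h)] at this
  linarith

theorem lipschitzWith_ramp : LipschitzWith (δ⁻¹).toNNReal (ramp t δ) :=
  .of_dist_le_mul fun x y => by
    rw [Real.dist_eq, Real.dist_eq, Real.coe_toNNReal _ (inv_nonneg.2 hδ.le), ramp, ramp,
      max_comm 0, max_comm 0, min_comm 1, min_comm 1]
    refine (abs_max_sub_max_le_abs _ _ _).trans ((abs_inf_sub_inf_le_abs _ _ _).trans_eq ?_)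
    rw [show 1 - (x - t) / δ - (1 - (y - t) / δ) = -(δ⁻¹ * (x - y)) by ring, abs_neg, abs_mul,
      abs_of_pos (inv_pos.2 hδ)]

theorem integrable_ramp (P : Measure ℝ) [IsFiniteMeasure P] : Integrable (ramp t δ) P :=
  .of_mem_Icc 0 1 (lipschitzWith_ramp hδ t).continuous.aemeasurable
    (.of_forall fun x => ramp_mem_Icc t δ x)

theorem measureReal_Iic_le_integral_ramp (P : Measure ℝ) [IsFiniteMeasure P] :
    P.real (Iic t) ≤ ∫ x, ramp t δ x ∂P := by
  rw [← integral_indicator_one measurableSet_Iic]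
  refine integral_mono ((integrable_const 1).indicator measurableSet_Iic)
    (integrable_ramp hδ t P) fun x => ?_
  by_cases hx : x ≤ t
  · simp [hx, ramp_of_le hδ hx]
  · simp [hx, (ramp_mem_Icc t δ x).1]

theorem integral_ramp_le_measureReal_Iic (P : Measure ℝ) [IsFiniteMeasure P] :
    ∫ x, ramp t δ x ∂P ≤ P.real (Iic (t + δ)) := by
  rw [← integral_indicator_one measurableSet_Iic]
  refine integral_mono (integrable_ramp hδ t P)
    ((integrable_const 1).indicator measurableSet_Iic) fun x => ?_
  by_cases hx : x ≤ t + δ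
  · simp [hx, (ramp_mem_Icc t δ x).2]
  · simp [hx, ramp_of_ge hδ (not_le.1 hx).le]

theorem integral_ramp_gaussianReal_std_le :
    ∫ x, ramp t δ x ∂γ ≤ (γ).real (Iic t) + (√(2 * Real.pi))⁻¹ * δ / 2 := by
  have hi := integrable_gaussianReal_std_iff.1 (integrable_ramp hδ t γ)
  have hIic : ∫ x in Iic t, ramp t δ x ∂γ = (γ).real (Iic t) := by
    rw [setIntegral_congr_fun measurableSet_Iic fun x hx => ramp_of_le hδ hx]
    simp
  have hIoi : ∫ x in Ioi (t + δ), ramp t δ x * ϕ x = 0 :=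
    setIntegral_eq_zero_of_forall_eq_zero fun x hx => by rw [ramp_of_ge hδ (le_of_lt hx), zero_mul]
  have hmid : ∫ x in t..t + δ, ramp t δ x * ϕ x ≤ (√(2 * Real.pi))⁻¹ * δ / 2 := by
    calc ∫ x in t..t + δ, ramp t δ x * ϕ x
        ≤ ∫ x in t..t + δ, (1 - (x - t) / δ) * (√(2 * Real.pi))⁻¹ := by
          refine intervalIntegral.integral_mono_on (by linarith) hi.intervalIntegrable
            (Continuous.intervalIntegrable (by fun_prop) _ _) fun x hx => ?_
          have hx0 : 0 ≤ (x - t) / δ := div_nonneg (by linarith [hx.1]) hδ.le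
          have hx1 : (x - t) / δ ≤ 1 := (div_le_one hδ).2 (by linarith [hx.2])
          rw [ramp, min_eq_right (by linarith), max_eq_right (by linarith)]
          exact mul_le_mul_of_nonneg_left (gaussianPDFReal_std_le x) (by linarith)
      _ = (√(2 * Real.pi))⁻¹ * δ / 2 := by
          rw [intervalIntegral.integral_mul_const, intervalIntegral.integral_sub (by simp)
            (Continuous.intervalIntegrable (by fun_prop) _ _), intervalIntegral.integral_div,
            intervalIntegral.integral_sub (by simp) (by simp), integral_id]
          simp only [intervalIntegral.integral_const, smul_eq_mul]
          field_simp
          ring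
  rw [setIntegral_gaussianReal_std] at hIic
  rw [← setIntegral_univ, setIntegral_gaussianReal_std, setIntegral_univ,
    ← intervalIntegral.integral_Iic_add_Ioi hi.integrableOn hi.integrableOn (b := t + δ), hIoi,
    ← sub_add_cancel (∫ x in Iic (t + δ), _) (∫ x in Iic t, ramp t δ x * ϕ x),
    intervalIntegral.integral_Iic_sub_Iic hi.integrableOn hi.integrableOn, hIic]
  linarith

theorem le_integral_ramp_gaussianReal_std :
    (γ).real (Iic (t + δ)) - (√(2 * Real.pi))⁻¹ * δ / 2 ≤ ∫ x, ramp t δ x ∂γ := by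
  have hneg : (γ).map (fun x => -x) = γ := by rw [gaussianReal_map_neg, neg_zero]
  have hint : ∫ x, ramp (-(t + δ)) δ x ∂γ = 1 - ∫ x, ramp t δ x ∂γ := by
    rw [← hneg, integral_map (by fun_prop)
      (lipschitzWith_ramp hδ _).continuous.aestronglyMeasurable, hneg]
    simp only [← one_sub_ramp hδ]
    rw [integral_sub (integrable_const 1) (integrable_ramp hδ t γ)]
    simp
  have hmeas : (γ).real (Iic (-(t + δ))) = 1 - (γ).real (Iic (t + δ)) := by
    have := nullSingletonClass_gaussianReal (μ := 0) (one_ne_zero (α := ℝ≥0))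
    rw [← hneg, map_measureReal_apply (by fun_prop) measurableSet_Iic, hneg, neg_preimage, neg_Iic,
      neg_neg, measureReal_congr Ioi_ae_eq_Ici.symm]
    linarith [measureReal_Iic_add_Ioi (P := γ) (t + δ)]
  have := integral_ramp_gaussianReal_std_le hδ (-(t + δ))
  rw [hint, hmeas] at this
  linarith

end Ramp

theorem le_add_sqrt_of_forall_pos {x s κ b : ℝ} (hκ : 0 < κ) (hb : 0 ≤ b)
    (h : ∀ δ, 0 < δ → x ≤ s + (κ * δ / 2 + b / (2 * δ))) : x ≤ s + √(κ * b) := by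
  rcases hb.eq_or_lt with rfl | hb
  · simp only [mul_zero, Real.sqrt_zero, add_zero]
    refine le_of_forall_pos_le_add fun ε hε => (h (2 * ε / κ) (by positivity)).trans_eq ?_
    field_simp
    ring
  · refine (h (√(κ * b) / κ) (by positivity)).trans_eq ?_
    have hs : √(κ * b) ^ 2 = κ * b := Real.sq_sqrt (by positivity)
    have : 0 < √(κ * b) := by positivity
    congr 1
    field_simp
    linear_combination -hs

theorem abs_measureReal_Iic_sub_gaussianReal_std_le {P : Measure ℝ} [IsProbabilityMeasure P]
    {s b : ℝ} (hb : 0 ≤ b) (h : ∀ t δ, 0 < δ →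
      |(∫ x, ramp t δ x ∂P) - ∫ x, ramp t δ x ∂γ| ≤ s + b / (2 * δ)) (x₀ : ℝ) :
    |P.real (Iic x₀) - (γ).real (Iic x₀)| ≤ s + √((√(2 * Real.pi))⁻¹ * b) := by
  refine le_add_sqrt_of_forall_pos (by positivity) hb fun δ hδ => abs_le.2 ⟨?_, ?_⟩
  · have := (abs_le.1 (h (x₀ - δ) δ hδ)).1
    have hP := integral_ramp_le_measureReal_Iic hδ (x₀ - δ) P
    have hγ := le_integral_ramp_gaussianReal_std hδ (x₀ - δ)
    rw [sub_add_cancel] at hP hγ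
    linarith
  · have := (abs_le.1 (h x₀ δ hδ)).2
    linarith [measureReal_Iic_le_integral_ramp hδ x₀ P, integral_ramp_gaussianReal_std_le hδ x₀]

end Gaussian

/-! ### Stein pairs -/

section SteinPair

local notation "γ" => gaussianReal 0 1

section Moments

variable {Ω : Type*} {m m0 : MeasurableSpace Ω} {P : Measure Ω} {X Y : Ω → ℝ}

theorem integral_abs_mul_abs_le_sqrt_mul_sqrt (hX : MemLp X 2 P) (hY : MemLp Y 2 P) :
    ∫ ξ, |X ξ| * |Y ξ| ∂P ≤ √(∫ ξ, X ξ ^ 2 ∂P) * √(∫ ξ, Y ξ ^ 2 ∂P) := by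
  have h := integral_mul_norm_le_Lp_mul_Lq Real.HolderConjugate.two_two (μ := P) (f := X) (g := Y)
    (by simpa using hX) (by simpa using hY)
  simpa [Real.sqrt_eq_rpow] using h

theorem pow_mul_pow_le_one_add_pow_add_pow {x y : ℝ} (hx : 0 ≤ x) (hy : 0 ≤ y) {i j n : ℕ}
    (h : i + j ≤ n) : x ^ i * y ^ j ≤ 1 + x ^ n + y ^ n := by
  wlog hxy : y ≤ x generalizing x y i j
  · linarith [this hy hx ((add_comm j i).trans_le h) (not_le.1 hxy).le, mul_comm (x ^ i) (y ^ j)]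
  have hle : x ^ i * y ^ j ≤ x ^ (i + j) := by
    rw [pow_add]
    gcongr
  rcases le_total x 1 with hx1 | hx1
  · linarith [pow_le_one₀ hx hx1 (n := i + j), pow_nonneg hx n, pow_nonneg hy n]
  · linarith [pow_le_pow_right₀ hx1 h, pow_nonneg hy n]

theorem integrable_pow_mul_pow [IsFiniteMeasure P] {n : ℕ} (hX : MemLp X n P) (hY : MemLp Y n P)
    {i j : ℕ} (h : i + j ≤ n) : Integrable (fun ξ => X ξ ^ i * Y ξ ^ j) P := by
  refine (((integrable_const 1).add hX.integrable_norm_pow').add hY.integrable_norm_pow').mono'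
    ((hX.aestronglyMeasurable.pow i).mul (hY.aestronglyMeasurable.pow j))
    (.of_forall fun ξ => ?_)
  rw [norm_mul, norm_pow, norm_pow]
  exact pow_mul_pow_le_one_add_pow_add_pow (norm_nonneg _) (norm_nonneg _) h

theorem integral_mul_condExp (hm : m ≤ m0) [SigmaFinite (P.trim hm)]
    (hX : StronglyMeasurable[m] X) (hXY : Integrable (fun ξ => X ξ * Y ξ) P)
    (hY : Integrable Y P) : ∫ ξ, X ξ * (P[Y|m]) ξ ∂P = ∫ ξ, X ξ * Y ξ ∂P := by
  rw [← integral_condExp hm (f := fun ξ => X ξ * Y ξ)]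
  exact integral_congr_ae (condExp_mul_of_stronglyMeasurable_left hX hXY hY).symm

theorem abs_integral_mul_le_mul_sqrt [IsProbabilityMeasure P] {M : ℝ} (hM : 0 ≤ M)
    (hX : ∀ ξ, |X ξ| ≤ M) (hY : MemLp Y 2 P) :
    |∫ ξ, X ξ * Y ξ ∂P| ≤ M * √(∫ ξ, Y ξ ^ 2 ∂P) := by
  have hi : Integrable (fun ξ => M * |Y ξ|) P := (hY.integrable (by norm_num)).norm.const_mul M
  have h := integral_abs_mul_abs_le_sqrt_mul_sqrt (memLp_const 1) hY
  simp only [abs_one, one_mul, one_pow, integral_const, probReal_univ, one_smul, Real.sqrt_one]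
    at h
  refine (norm_integral_le_of_norm_le (f := fun ξ => X ξ * Y ξ) hi
    (.of_forall fun ξ => ?_)).trans ?_
  · rw [norm_mul]
    exact mul_le_mul_of_nonneg_right (hX ξ) (abs_nonneg _)
  · rw [integral_const_mul]
    exact mul_le_mul_of_nonneg_left h hM

end Moments

theorem sqrt_inv_sqrt_two_pi_mul_sqrt {a b : ℝ} (ha : 0 < a) (hb : 0 ≤ b) :
    √((√(2 * Real.pi))⁻¹ * (√(2 * a) * √b / a)) = (1 / Real.pi * (b / a)) ^ (1 / 4 : ℝ) := by
  have h : (√(2 * Real.pi))⁻¹ * (√(2 * a) * √b / a) = √(1 / Real.pi * (b / a)) := by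
    refine ((Real.sqrt_eq_iff_eq_sq (by positivity) (by positivity)).2 ?_).symm
    rw [mul_pow, div_pow, mul_pow, inv_pow, Real.sq_sqrt (by positivity),
      Real.sq_sqrt (by positivity), Real.sq_sqrt hb]
    field_simp
  rw [h, Real.sqrt_eq_rpow, Real.sqrt_eq_rpow, ← Real.rpow_mul (by positivity)]
  norm_num

/-- The exchangeable pairs `(W, W')` of Stein's method: the regression of `W'` on the
σ-algebra `m`, with respect to which `W` is measurable, is `(1 - a) * W`. Finite fourth moments
are part of the definition. -/
structure IsSteinPair {Ω : Type*} (m : MeasurableSpace Ω) {m0 : MeasurableSpace Ω}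
    (P : Measure Ω) (W W' : Ω → ℝ) (a : ℝ) : Prop where
  le : m ≤ m0
  stronglyMeasurable : StronglyMeasurable[m] W
  memLp : MemLp W 4 P
  identDistrib : IdentDistrib (fun ξ => (W ξ, W' ξ)) (fun ξ => (W' ξ, W ξ)) P P
  condExp_ae_eq : P[W'|m] =ᵐ[P] fun ξ => (1 - a) * W ξ

namespace IsSteinPair

variable {Ω : Type*} {m m0 : MeasurableSpace Ω} {P : Measure Ω} [IsProbabilityMeasure P]
  {W W' : Ω → ℝ} {a : ℝ} (hW : IsSteinPair m P W W' a)

include hW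

omit [IsProbabilityMeasure P] in
theorem integral_swap {u : ℝ × ℝ → ℝ} (hu : Measurable u) :
    ∫ ξ, u (W ξ, W' ξ) ∂P = ∫ ξ, u (W' ξ, W ξ) ∂P :=
  (hW.identDistrib.comp hu).integral_eq

omit [IsProbabilityMeasure P] in
theorem memLp_right : MemLp W' 4 P :=
  (hW.identDistrib.comp measurable_fst).memLp_iff.1 hW.memLp

omit [IsProbabilityMeasure P] in
theorem memLp_sub : MemLp (fun ξ => W' ξ - W ξ) 4 P := hW.memLp_right.sub hW.memLp

theorem memLp_two : MemLp W 2 P := hW.memLp.mono_exponent (by norm_num)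

theorem memLp_two_right : MemLp W' 2 P := hW.memLp_right.mono_exponent (by norm_num)

theorem integrable_pow_mul_pow {i j : ℕ} (h : i + j ≤ 4) :
    Integrable (fun ξ => W ξ ^ i * W' ξ ^ j) P :=
  CompactLieCLT.integrable_pow_mul_pow (n := 4) (mod_cast hW.memLp) (mod_cast hW.memLp_right) h

theorem integrable_abs_sub_pow {i : ℕ} (h : i ≤ 4) :
    Integrable (fun ξ => |W' ξ - W ξ| ^ i) P := by
  have hn : MemLp (fun ξ => |W' ξ - W ξ|) (4 : ℕ) P := mod_cast hW.memLp_sub.norm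
  simpa using CompactLieCLT.integrable_pow_mul_pow hn hn (j := 0) h

theorem integral_mul_right {X : Ω → ℝ} (hX : StronglyMeasurable[m] X)
    (hXW : Integrable (fun ξ => X ξ * W' ξ) P) :
    ∫ ξ, X ξ * W' ξ ∂P = (1 - a) * ∫ ξ, X ξ * W ξ ∂P := by
  have hi : Integrable W' P := by simpa using hW.integrable_pow_mul_pow (i := 0) (j := 1)
  rw [← integral_mul_condExp hW.le hX hXW hi, ← integral_const_mul]
  refine integral_congr_ae (hW.condExp_ae_eq.mono fun ξ hξ => ?_)
  simp only [hξ]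
  ring

theorem integral_sq_sub : ∫ ξ, (W' ξ - W ξ) ^ 2 ∂P = 2 * a * ∫ ξ, W ξ ^ 2 ∂P := by
  have hswap := hW.integral_swap (u := fun p => p.2 ^ 2) (by fun_prop)
  have h02 : Integrable (fun ξ => W' ξ ^ 2) P := by
    simpa using hW.integrable_pow_mul_pow (i := 0) (j := 2)
  have h11 : Integrable (fun ξ => W ξ * W' ξ) P := by
    simpa using hW.integrable_pow_mul_pow (i := 1) (j := 1)
  have h20 : Integrable (fun ξ => W ξ ^ 2) P := by
    simpa using hW.integrable_pow_mul_pow (i := 2) (j := 0)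
  have hreg := hW.integral_mul_right hW.stronglyMeasurable h11
  simp only [← sq] at hreg
  have hexp (ξ : Ω) : (W' ξ - W ξ) ^ 2 = W' ξ ^ 2 - 2 * (W ξ * W' ξ) + W ξ ^ 2 := by ring
  simp only [hexp]
  rw [integral_add (by fun_prop) h20, integral_sub h02 (by fun_prop), integral_const_mul, hreg,
    hswap]
  ring

theorem integral_pow_four_sub : ∫ ξ, (W' ξ - W ξ) ^ 4 ∂P =
    (8 * a - 6) * (∫ ξ, W ξ ^ 4 ∂P) + 6 * ∫ ξ, W ξ ^ 2 * W' ξ ^ 2 ∂P := by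
  have hswap₀ := hW.integral_swap (u := fun p => p.2 ^ 4) (by fun_prop)
  have hswap₁ := hW.integral_swap (u := fun p => p.1 * p.2 ^ 3) (by fun_prop)
  have h04 : Integrable (fun ξ => W' ξ ^ 4) P := by
    simpa using hW.integrable_pow_mul_pow (i := 0) (j := 4)
  have h13 : Integrable (fun ξ => W ξ * W' ξ ^ 3) P := by
    simpa using hW.integrable_pow_mul_pow (i := 1) (j := 3)
  have h22 : Integrable (fun ξ => W ξ ^ 2 * W' ξ ^ 2) P := hW.integrable_pow_mul_pow le_rfl
  have h31 : Integrable (fun ξ => W ξ ^ 3 * W' ξ) P := by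
    simpa using hW.integrable_pow_mul_pow (i := 3) (j := 1)
  have h40 : Integrable (fun ξ => W ξ ^ 4) P := by
    simpa using hW.integrable_pow_mul_pow (i := 4) (j := 0)
  have hreg := hW.integral_mul_right (hW.stronglyMeasurable.pow 3) h31
  simp only [Pi.pow_apply, ← pow_succ, mul_comm (W' _)] at hreg hswap₁
  have hexp (ξ : Ω) : (W' ξ - W ξ) ^ 4 = W' ξ ^ 4 - 4 * (W ξ * W' ξ ^ 3) +
      6 * (W ξ ^ 2 * W' ξ ^ 2) - 4 * (W ξ ^ 3 * W' ξ) + W ξ ^ 4 := by ring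
  simp only [hexp]
  rw [integral_add (by fun_prop) h40, integral_sub (by fun_prop) (by fun_prop),
    integral_add (by fun_prop) (by fun_prop), integral_sub h04 (by fun_prop)]
  simp only [integral_const_mul]
  rw [hswap₁, hreg, hswap₀]
  ring

theorem memLp_sq_sub : MemLp (fun ξ => (W' ξ - W ξ) ^ 2) 2 P := by
  refine (memLp_two_iff_integrable_sq (hW.memLp_sub.aestronglyMeasurable.pow 2)).2 ?_
  simpa [← pow_mul, (show Even 4 by decide).pow_abs] using hW.integrable_abs_sub_pow le_rfl

theorem integral_abs_cube_sub_le : ∫ ξ, |W' ξ - W ξ| ^ 3 ∂P ≤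
    √(∫ ξ, (W' ξ - W ξ) ^ 2 ∂P) * √(∫ ξ, (W' ξ - W ξ) ^ 4 ∂P) := by
  have h := integral_abs_mul_abs_le_sqrt_mul_sqrt (hW.memLp_sub.mono_exponent (by norm_num))
    hW.memLp_sq_sub
  simpa only [abs_pow, ← pow_succ', ← pow_mul, Nat.reduceAdd, Nat.reduceMul] using h

section TestFunction

variable {f : ℝ → ℝ} {M K : ℝ≥0}

theorem integral_sub_mul_comp_sub_comp (hM : LipschitzWith M f) :
    ∫ ξ, (W' ξ - W ξ) * (f (W' ξ) - f (W ξ)) ∂P = 2 * a * ∫ ξ, f (W ξ) * W ξ ∂P := by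
  have hf := hM.continuous
  have hW2 := hW.memLp_two
  have hW2' := hW.memLp_two_right
  have hfW := memLp_comp_of_lipschitzWith hM hW2
  have hfW' := memLp_comp_of_lipschitzWith hM hW2'
  have h00 : Integrable (fun ξ => f (W ξ) * W ξ) P := hfW.integrable_mul hW2
  have h01 : Integrable (fun ξ => f (W ξ) * W' ξ) P := hfW.integrable_mul hW2'
  have h10 : Integrable (fun ξ => f (W' ξ) * W ξ) P := hfW'.integrable_mul hW2
  have h11 : Integrable (fun ξ => f (W' ξ) * W' ξ) P := hfW'.integrable_mul hW2'
  have hswap₀ := hW.integral_swap (u := fun p => f p.1 * p.1) (by fun_prop)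
  have hswap₁ := hW.integral_swap (u := fun p => f p.1 * p.2) (by fun_prop)
  have hreg := hW.integral_mul_right (hf.comp_stronglyMeasurable hW.stronglyMeasurable) h01
  have hexp (ξ : Ω) : (W' ξ - W ξ) * (f (W' ξ) - f (W ξ)) =
      f (W' ξ) * W' ξ - f (W' ξ) * W ξ - f (W ξ) * W' ξ + f (W ξ) * W ξ := by ring
  simp only [hexp]
  rw [integral_add (by fun_prop) h00, integral_sub (by fun_prop) h01, integral_sub h11 h10,
    ← hswap₀, ← hswap₁, hreg]
  ring

theorem abs_integral_deriv_mul_condExp_sub_le (hfd : Differentiable ℝ f) (hM : LipschitzWith M f)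
    (hK : LipschitzWith K (deriv f)) :
    |(∫ ξ, deriv f (W ξ) * (P[fun ξ => (W' ξ - W ξ) ^ 2|m]) ξ ∂P) -
      2 * a * ∫ ξ, f (W ξ) * W ξ ∂P| ≤ K / 2 * ∫ ξ, |W' ξ - W ξ| ^ 3 ∂P := by
  have hsq : Integrable (fun ξ => (W' ξ - W ξ) ^ 2) P := by
    simpa using hW.integrable_abs_sub_pow (i := 2) (by norm_num)
  have hderiv := hK.continuous.comp_stronglyMeasurable hW.stronglyMeasurable
  have hprod : Integrable (fun ξ => deriv f (W ξ) * (W' ξ - W ξ) ^ 2) P :=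
    hsq.bdd_mul (hderiv.mono hW.le).aestronglyMeasurable
      (.of_forall fun ξ => norm_deriv_le_of_lipschitz hM)
  have hcross : Integrable (fun ξ => (W' ξ - W ξ) * (f (W' ξ) - f (W ξ))) P :=
    (hW.memLp_two_right.sub hW.memLp_two).integrable_mul
      ((memLp_comp_of_lipschitzWith hM hW.memLp_two_right).sub
        (memLp_comp_of_lipschitzWith hM hW.memLp_two))
  rw [integral_mul_condExp hW.le hderiv hprod hsq, ← hW.integral_sub_mul_comp_sub_comp hM,
    ← integral_sub hprod hcross, ← integral_const_mul]
  refine norm_integral_le_of_norm_le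
    (f := fun ξ => deriv f (W ξ) * (W' ξ - W ξ) ^ 2 - (W' ξ - W ξ) * (f (W' ξ) - f (W ξ)))
    ((hW.integrable_abs_sub_pow (i := 3) (by norm_num)).const_mul (K / 2 : ℝ))
    (.of_forall fun ξ => ?_)
  have htaylor := abs_sub_sub_mul_deriv_le hfd hK (W ξ) (W' ξ)
  calc ‖deriv f (W ξ) * (W' ξ - W ξ) ^ 2 - (W' ξ - W ξ) * (f (W' ξ) - f (W ξ))‖
      = |W' ξ - W ξ| * |f (W' ξ) - f (W ξ) - (W' ξ - W ξ) * deriv f (W ξ)| := by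
        rw [← abs_mul, ← abs_neg, Real.norm_eq_abs]
        ring_nf
    _ ≤ |W' ξ - W ξ| * (K / 2 * (W' ξ - W ξ) ^ 2) := by gcongr
    _ = K / 2 * |W' ξ - W ξ| ^ 3 := by rw [← sq_abs]; ring

theorem memLp_condExp_sq_sub : MemLp (P[fun ξ => (W' ξ - W ξ) ^ 2|m]) 2 P :=
  hW.memLp_sq_sub.condExp (by norm_num)

theorem abs_integral_deriv_comp_sub_le (ha : 0 < a) (hfd : Differentiable ℝ f)
    (hM : LipschitzWith M f) (hK : LipschitzWith K (deriv f)) :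
    |∫ ξ, (deriv f (W ξ) - f (W ξ) * W ξ) ∂P| ≤
      M / 2 * √(∫ ξ, (2 - (P[fun ξ => (W' ξ - W ξ) ^ 2|m]) ξ / a) ^ 2 ∂P) +
        K / (4 * a) * ∫ ξ, |W' ξ - W ξ| ^ 3 ∂P := by
  have htaylor := hW.abs_integral_deriv_mul_condExp_sub_le hfd hM hK
  have hD := hW.memLp_condExp_sq_sub
  set D := P[fun ξ => (W' ξ - W ξ) ^ 2|m]
  have hbdd (ξ : Ω) : |deriv f (W ξ)| ≤ M := norm_deriv_le_of_lipschitz hM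
  have hmeas : AEStronglyMeasurable (fun ξ => deriv f (W ξ)) P :=
    (hK.continuous.comp_stronglyMeasurable (hW.stronglyMeasurable.mono hW.le)).aestronglyMeasurable
  have hfE := abs_integral_mul_le_mul_sqrt M.coe_nonneg hbdd
    (Y := fun ξ => 2 - D ξ / a) ((memLp_const 2).sub (hD.mul_const a⁻¹))
  have hfD : Integrable (fun ξ => deriv f (W ξ) * D ξ) P :=
    (hD.integrable (by norm_num)).bdd_mul hmeas (.of_forall hbdd)
  have hf' : Integrable (fun ξ => deriv f (W ξ)) P := .of_bound hmeas M (.of_forall hbdd)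
  have hfW : Integrable (fun ξ => f (W ξ) * W ξ) P :=
    (memLp_comp_of_lipschitzWith hM hW.memLp_two).integrable_mul hW.memLp_two
  have hid : ∫ ξ, (deriv f (W ξ) - f (W ξ) * W ξ) ∂P =
      (∫ ξ, deriv f (W ξ) * (2 - D ξ / a) ∂P) / 2 +
        ((∫ ξ, deriv f (W ξ) * D ξ ∂P) - 2 * a * ∫ ξ, f (W ξ) * W ξ ∂P) / (2 * a) := by
    simp only [mul_sub, mul_div_assoc']
    rw [integral_sub hf' hfW, integral_sub (hf'.mul_const 2) (hfD.div_const a),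
      integral_mul_const, integral_div]
    field_simp
    ring
  rw [hid]
  calc _ ≤ |∫ ξ, deriv f (W ξ) * (2 - D ξ / a) ∂P| / 2 +
        |(∫ ξ, deriv f (W ξ) * D ξ ∂P) - 2 * a * ∫ ξ, f (W ξ) * W ξ ∂P| / (2 * a) :=
        (abs_add_le _ _).trans_eq (by rw [abs_div, abs_div, abs_two, abs_of_pos (a := 2 * a)
          (by positivity)])
    _ ≤ M * √(∫ ξ, (2 - D ξ / a) ^ 2 ∂P) / 2 +
        K / 2 * (∫ ξ, |W' ξ - W ξ| ^ 3 ∂P) / (2 * a) := by gcongr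
    _ = _ := by ring

end TestFunction

theorem abs_integral_comp_sub_integral_gaussianReal_std_le (ha : 0 < a) {h : ℝ → ℝ} {L : ℝ≥0}
    (hL : LipschitzWith L h) (h01 : ∀ x, h x ∈ Icc 0 1) :
    |(∫ ξ, h (W ξ) ∂P) - ∫ x, h x ∂γ| ≤
      √(∫ ξ, (2 - (P[fun ξ => (W' ξ - W ξ) ^ 2|m]) ξ / a) ^ 2 ∂P) +
        L * (∫ ξ, |W' ξ - W ξ| ^ 3 ∂P) / (2 * a) := by
  have hstein (x : ℝ) :
      deriv (steinSolution h) x - steinSolution h x * x = h x - ∫ x, h x ∂γ := by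
    rw [(hasDerivAt_steinSolution hL x).deriv]
    ring
  have hhW : Integrable (fun ξ => h (W ξ)) P :=
    (memLp_comp_of_lipschitzWith hL hW.memLp).integrable (by norm_num)
  have hbound := hW.abs_integral_deriv_comp_sub_le ha (differentiable_steinSolution hL)
    (lipschitzWith_steinSolution hL h01) (lipschitzWith_deriv_steinSolution hL)
  simp only [hstein] at hbound
  rw [integral_sub hhW (integrable_const _), integral_const, probReal_univ, one_smul] at hbound
  refine hbound.trans_eq ?_
  push_cast
  ring

theorem abs_measureReal_le_sub_gaussianReal_std_le (ha : 0 < a) (x₀ : ℝ) :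
    |P.real {ξ | W ξ ≤ x₀} - (γ).real (Iic x₀)| ≤
      √(∫ ξ, (2 - (P[fun ξ => (W' ξ - W ξ) ^ 2|m]) ξ / a) ^ 2 ∂P) +
        √((√(2 * Real.pi))⁻¹ * ((∫ ξ, |W' ξ - W ξ| ^ 3 ∂P) / a)) := by
  have hWm : Measurable W := (hW.stronglyMeasurable.mono hW.le).measurable
  have := Measure.isProbabilityMeasure_map hWm.aemeasurable (μ := P)
  have hmap : P.real {ξ | W ξ ≤ x₀} = (P.map W).real (Iic x₀) :=
    (map_measureReal_apply hWm measurableSet_Iic).symm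
  rw [hmap]
  refine abs_measureReal_Iic_sub_gaussianReal_std_le
    (div_nonneg (integral_nonneg fun ξ => by positivity) ha.le) (fun t δ hδ => ?_) x₀
  have hlip := lipschitzWith_ramp hδ t
  rw [integral_map hWm.aemeasurable hlip.continuous.aestronglyMeasurable]
  refine (hW.abs_integral_comp_sub_integral_gaussianReal_std_le ha hlip
    (ramp_mem_Icc t δ)).trans_eq ?_
  rw [Real.coe_toNNReal _ (inv_nonneg.2 hδ.le)]
  field_simp

theorem pos_of_ne_zero (hvar : ∫ ξ, W ξ ^ 2 ∂P = 1) (ha0 : a ≠ 0) : 0 < a := by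
  have h : 0 ≤ ∫ ξ, (W' ξ - W ξ) ^ 2 ∂P := integral_nonneg fun ξ => sq_nonneg _
  rw [hW.integral_sq_sub, hvar] at h
  exact lt_of_le_of_ne (by linarith) ha0.symm

theorem abs_measureReal_le_sub_gaussianReal_std_le_of_variance_eq_one
    (hvar : ∫ ξ, W ξ ^ 2 ∂P = 1) (ha0 : a ≠ 0) (x₀ : ℝ) :
    |P.real {ξ | W ξ ≤ x₀} - (γ).real (Iic x₀)| ≤
      √(∫ ξ, (2 - (P[fun ξ => (W' ξ - W ξ) ^ 2|m]) ξ / a) ^ 2 ∂P) +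
        (1 / Real.pi * ((∫ ξ, (W' ξ - W ξ) ^ 4 ∂P) / a)) ^ (1 / 4 : ℝ) := by
  have ha := hW.pos_of_ne_zero hvar ha0
  refine (hW.abs_measureReal_le_sub_gaussianReal_std_le ha x₀).trans ?_
  have hcube := hW.integral_abs_cube_sub_le
  rw [hW.integral_sq_sub, hvar, mul_one] at hcube
  have hF : 0 ≤ ∫ ξ, (W' ξ - W ξ) ^ 4 ∂P := integral_nonneg fun ξ => by positivity
  set F := ∫ ξ, (W' ξ - W ξ) ^ 4 ∂P
  rw [← sqrt_inv_sqrt_two_pi_mul_sqrt ha hF]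
  gcongr

end IsSteinPair
end SteinPair

/-! ### Continuous representations of compact groups -/

section WeaklyContinuous

variable {X Y U U₁ U₂ : Type*} [AddCommGroup U] [Module ℂ U]
  [AddCommGroup U₁] [Module ℂ U₁] [AddCommGroup U₂] [Module ℂ U₂]

theorem dual_apply_eq_sum_coord_mul {ι : Type*} [Fintype ι] (b : Module.Basis ι ℂ U)
    (l : Module.Dual ℂ U) (u : U) : l u = ∑ i, b.coord i u * l (b i) := by
  conv_lhs => rw [← b.sum_repr u]
  simp only [map_sum, map_smul, smul_eq_mul, Module.Basis.coord_apply]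

theorem dual_apply_linearMap_eq_sum {ι : Type*} [Fintype ι] (b : Module.Basis ι ℂ U₁)
    (l : Module.Dual ℂ (U₁ →ₗ[ℂ] U₂)) (T : U₁ →ₗ[ℂ] U₂) :
    l T = ∑ i, (l ∘ₗ LinearMap.smulRightₗ (b.coord i)) (T (b i)) := by
  have hT : T = ∑ i, (b.coord i).smulRight (T (b i)) := b.ext fun k => by
    classical
    simp [Finsupp.single_apply, ite_smul]
  conv_lhs => rw [hT]
  simp

variable [TopologicalSpace X] [TopologicalSpace Y]

/-- A vector-valued map is weakly continuous if its composition with every linear functional is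
continuous. This makes it possible to integrate maps into finite-dimensional spaces that carry no
topology. -/
def WeaklyContinuous (F : X → U) : Prop :=
  ∀ l : Module.Dual ℂ U, Continuous fun x => l (F x)

theorem WeaklyContinuous.comp_continuous {F : X → U} (hF : WeaklyContinuous F) {p : Y → X}
    (hp : Continuous p) : WeaklyContinuous fun y => F (p y) := fun l => (hF l).comp hp

theorem weaklyContinuous_linearMap [FiniteDimensional ℂ U₁] {F : X → U₁ →ₗ[ℂ] U₂}
    (h : ∀ (u : U₁) (l : Module.Dual ℂ U₂), Continuous fun x => l (F x u)) :
    WeaklyContinuous F := fun l => by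
  simp only [dual_apply_linearMap_eq_sum (Module.finBasis ℂ U₁)]
  exact continuous_finsetSum _ fun i _ => h _ _

theorem WeaklyContinuous.map₂ [FiniteDimensional ℂ U₁] {F₁ : X → U₁} {F₂ : X → U₂}
    (h₁ : WeaklyContinuous F₁) (h₂ : WeaklyContinuous F₂) (B : U₁ →ₗ[ℂ] U₂ →ₗ[ℂ] U) :
    WeaklyContinuous fun x => B (F₁ x) (F₂ x) := fun l => by
  simp only [← LinearMap.compr₂_apply B l]
  let b := Module.finBasis ℂ U₁
  have hsum (x : X) : (B.compr₂ l) (F₁ x) (F₂ x) =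
      ∑ i, b.coord i (F₁ x) * (B.compr₂ l) (b i) (F₂ x) :=
    dual_apply_eq_sum_coord_mul b ((B.compr₂ l).flip (F₂ x)) (F₁ x)
  simp only [hsum]
  exact continuous_finsetSum _ fun i _ => (h₁ _).mul (h₂ _)

theorem WeaklyContinuous.measurable_map₂ [FiniteDimensional ℂ U₁]
    [MeasurableSpace X] [BorelSpace X] [MeasurableSpace Y] [BorelSpace Y]
    {F₁ : X → U₁} {F₂ : Y → U₂} (h₁ : WeaklyContinuous F₁) (h₂ : WeaklyContinuous F₂)
    (B : U₁ →ₗ[ℂ] U₂ →ₗ[ℂ] ℂ) : Measurable fun p : X × Y => B (F₁ p.1) (F₂ p.2) := by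
  let b := Module.finBasis ℂ U₁
  have hsum (p : X × Y) : B (F₁ p.1) (F₂ p.2) =
      ∑ i, b.coord i (F₁ p.1) * B (b i) (F₂ p.2) :=
    dual_apply_eq_sum_coord_mul b (B.flip (F₂ p.2)) (F₁ p.1)
  simp only [hsum]
  exact Finset.measurable_fun_sum _ fun i _ =>
    ((h₁ _).measurable.comp measurable_fst).mul ((h₂ _).measurable.comp measurable_snd)

theorem integrable_of_continuous [CompactSpace X] [MeasurableSpace X] [BorelSpace X] {μ : Measure X}
    [IsFiniteMeasureOnCompacts μ] {F : X → ℂ} (hF : Continuous F) : Integrable F μ :=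
  hF.integrable_of_hasCompactSupport (.of_compactSpace F)

theorem WeaklyContinuous.exists_integral [CompactSpace X] [MeasurableSpace X] [BorelSpace X]
    (μ : Measure X) [IsFiniteMeasureOnCompacts μ] [FiniteDimensional ℂ U] {F : X → U}
    (hF : WeaklyContinuous F) :
    ∃ u : U, ∀ l : Module.Dual ℂ U, l u = ∫ x, l (F x) ∂μ := by
  let b := Module.finBasis ℂ U
  refine ⟨∑ i, (∫ x, b.coord i (F x) ∂μ) • b i, fun l => ?_⟩
  simp only [dual_apply_eq_sum_coord_mul b l (F _)]
  rw [integral_finsetSum _ fun i _ =>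
    (integrable_of_continuous (hF _)).mul_const _]
  simp only [map_sum, map_smul, smul_eq_mul, integral_mul_const]

end WeaklyContinuous

section Trace

variable {K V : Type*} [Field K] [AddCommGroup V] [Module K V] [FiniteDimensional K V]

theorem trace_eq_trace_restrict_add_trace_mapQ (f : V →ₗ[K] V) (U : Submodule K V)
    (hf : U ≤ U.comap f) :
    LinearMap.trace K V f =
      LinearMap.trace K U (f.restrict hf) + LinearMap.trace K (V ⧸ U) (U.mapQ U f hf) := by
  obtain ⟨C, hC⟩ := U.exists_isCompl
  let p := U.projectionOnto C hC
  let s : V ⧸ U →ₗ[K] V := C.subtype ∘ₗ U.quotientEquivOfIsCompl C hC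
  have hid : U.subtype ∘ₗ p + s ∘ₗ U.mkQ = LinearMap.id := by
    ext v
    simp [p, s, Submodule.projection_add_projection_eq_self]
  have hrestrict : p ∘ₗ f ∘ₗ U.subtype = f.restrict hf :=
    LinearMap.ext fun u => Submodule.projectionOnto_apply_left hC ⟨f u, hf u.2⟩
  have hmapQ : U.mkQ ∘ₗ f ∘ₗ s = U.mapQ U f hf := by
    have hs : U.mkQ ∘ₗ s = LinearMap.id :=
      LinearMap.ext (Submodule.mk_quotientEquivOfIsCompl_apply hC)
    rw [← LinearMap.comp_assoc, ← U.mapQ_mkQ U f (h := hf), LinearMap.comp_assoc, hs,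
      LinearMap.comp_id]
  rw [← hrestrict, ← hmapQ, ← LinearMap.trace_comp_comm' p, ← LinearMap.trace_comp_comm' U.mkQ,
    ← map_add, LinearMap.comp_assoc, LinearMap.comp_assoc, ← LinearMap.comp_add, hid,
    LinearMap.comp_id]

end Trace

section Irreducible

variable {G V W : Type*} [Group G]
  [AddCommGroup V] [Module ℂ V] [AddCommGroup W] [Module ℂ W]
  {ρ : Representation ℂ G V} {σ : Representation ℂ G W}

theorem isIrreducible_iff : ρ.IsIrreducible ↔ Nontrivial V ∧
    ∀ U : Submodule ℂ V, (∀ g, U ≤ U.comap (ρ g)) → U = ⊥ ∨ U = ⊤ := by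
  rw [Representation.irreducible_iff_isSimpleModule_asModule, isSimpleModule_iff,
    ← ρ.mapSubmodule.isSimpleOrder_iff, isSimpleOrder_iff,
    Representation.invtSubmodule.nontrivial_iff, Subtype.forall]
  simp only [Representation.mem_invtSubmodule, Module.End.mem_invtSubmodule, Subtype.ext_iff,
    Representation.invtSubmodule.coe_top, Representation.invtSubmodule.coe_bot]

theorem isIrreducible_of_equiv (e : ρ.Equiv σ) (h : ρ.IsIrreducible) : σ.IsIrreducible := by
  rw [Representation.irreducible_iff_isSimpleModule_asModule] at h ⊢
  exact IsSimpleModule.congr (LinearEquiv.ofBijective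
    (Representation.IntertwiningMap.equivLinearMapAsModule ρ σ e.toIntertwiningMap)
    e.toLinearEquiv.bijective).symm

theorem exists_eq_smul_id_of_commute [FiniteDimensional ℂ V] (hρ : ρ.IsIrreducible)
    {T : V →ₗ[ℂ] V} (hT : ∀ g, T ∘ₗ ρ g = ρ g ∘ₗ T) : ∃ c : ℂ, T = c • LinearMap.id := by
  let f : ρ.IntertwiningMap ρ := ⟨T, hT⟩
  obtain ⟨c, hc⟩ :=
    (Representation.IsIrreducible.algebraMap_intertwiningMap_bijective_of_isAlgClosed
      (k := ℂ) (ρ := ρ)).2 f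
  exact ⟨c, congrArg Representation.IntertwiningMap.toLinearMap hc.symm⟩

end Irreducible

section ContinuousRep

variable {G V W : Type*} [Group G] [TopologicalSpace G]
  [AddCommGroup V] [Module ℂ V] [AddCommGroup W] [Module ℂ W]
  {ρ : Representation ℂ G V} {σ : Representation ℂ G W}

namespace IsContinuousRep

theorem weaklyContinuous [FiniteDimensional ℂ V] (hρ : IsContinuousRep ρ) :
    WeaklyContinuous fun g => ρ g :=
  weaklyContinuous_linearMap hρ

theorem of_weaklyContinuous (hρ : WeaklyContinuous fun g => ρ g) : IsContinuousRep ρ :=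
  fun v l => hρ (l ∘ₗ LinearMap.applyₗ v)

theorem continuous_character [FiniteDimensional ℂ V] (hρ : IsContinuousRep ρ) :
    Continuous ρ.character :=
  hρ.weaklyContinuous (LinearMap.trace ℂ V)

theorem linHom [IsTopologicalGroup G] [FiniteDimensional ℂ V] [FiniteDimensional ℂ W]
    (hρ : IsContinuousRep ρ) (hσ : IsContinuousRep σ) : IsContinuousRep (ρ.linHom σ) :=
  fun f => hσ.weaklyContinuous.map₂ (hρ.weaklyContinuous.comp_continuous continuous_inv)
    ((LinearMap.llcomp ℂ V W W).compl₂ (LinearMap.llcomp ℂ V V W f))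

theorem tprod [FiniteDimensional ℂ V] [FiniteDimensional ℂ W]
    (hρ : IsContinuousRep ρ) (hσ : IsContinuousRep σ) : IsContinuousRep (ρ.tprod σ) :=
  of_weaklyContinuous (hρ.weaklyContinuous.map₂ hσ.weaklyContinuous
    (TensorProduct.mapBilinear (RingHom.id ℂ) V W V W))

theorem subrepresentation (hρ : IsContinuousRep ρ) (U : Submodule ℂ V)
    (hU : ∀ g, U ≤ U.comap (ρ g)) : IsContinuousRep (ρ.subrepresentation U hU) := fun u l => by
  obtain ⟨l', rfl⟩ := l.exists_extend
  exact hρ u l'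

theorem quotient (hρ : IsContinuousRep ρ) (U : Submodule ℂ V)
    (hU : ∀ g, U ≤ U.comap (ρ g)) : IsContinuousRep (ρ.quotient U hU) := fun v l => by
  obtain ⟨v, rfl⟩ := U.mkQ_surjective v
  exact hρ v (l ∘ₗ U.mkQ)

theorem of_equiv (e : ρ.Equiv σ) (hρ : IsContinuousRep ρ) : IsContinuousRep σ := fun w l => by
  have hσ (g : G) : σ g w = e (ρ g (e.symm w)) := by
    have := e.toIntertwiningMap.isIntertwining _ _ g (e.symm w)
    simp_all
  simp only [hσ]
  exact hρ _ (l ∘ₗ e.toLinearMap)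

end IsContinuousRep

omit [TopologicalSpace G] in
theorem character_eq_subrepresentation_add_quotient [FiniteDimensional ℂ V] (U : Submodule ℂ V)
    (hU : ∀ g, U ≤ U.comap (ρ g)) :
    ρ.character = (ρ.subrepresentation U hU).character + (ρ.quotient U hU).character :=
  funext fun g => trace_eq_trace_restrict_add_trace_mapQ (ρ g) U (hU g)

end ContinuousRep

section InvariantForm

variable {G n : Type*} [Group G] [TopologicalSpace G] [IsTopologicalGroup G] [CompactSpace G]
  [Fintype n] [DecidableEq n]

open scoped ComplexConjugate Matrix

omit [DecidableEq n] in
theorem star_dotProduct_conjTranspose_mul_self_mulVec (B : Matrix n n ℂ) (v : n → ℂ) :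
    star v ⬝ᵥ ((Bᴴ * B) *ᵥ v) = ((∑ i, ‖(B *ᵥ v) i‖ ^ 2 : ℝ) : ℂ) := by
  rw [← Matrix.mulVec_mulVec, Matrix.dotProduct_mulVec, ← Matrix.star_mulVec]
  simp [dotProduct, Complex.conj_mul']

omit [DecidableEq n] in
theorem integral_sum_norm_mulVec_sq_pos {X : Type*} [TopologicalSpace X] [CompactSpace X]
    [MeasurableSpace X] [BorelSpace X] (μ : Measure X) [IsFiniteMeasureOnCompacts μ]
    [μ.IsOpenPosMeasure] {B : X → Matrix n n ℂ} (hB : Continuous B) {v : n → ℂ} {x₀ : X}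
    (hv : B x₀ *ᵥ v ≠ 0) : 0 < ∫ x, ∑ i, ‖(B x *ᵥ v) i‖ ^ 2 ∂μ := by
  have : Continuous fun x => B x *ᵥ v := hB.matrix_mulVec continuous_const
  refine Continuous.integral_pos_of_hasCompactSupport_nonneg_nonzero (x := x₀) (by fun_prop)
    (.of_compactSpace _) (fun x => by positivity) fun h => hv ?_
  ext i
  rw [Finset.sum_eq_zero_iff_of_nonneg fun i _ => by positivity] at h
  simpa using h i (Finset.mem_univ i)

theorem exists_isUnit_conjTranspose_mul_mul_eq (A : G →* Matrix n n ℂ) (hA : Continuous A) :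
    ∃ M : Matrix n n ℂ, IsUnit M ∧ ∀ g, (A g)ᴴ * M * A g = M := by
  borelize G
  let N : G → Matrix n n ℂ := fun x => (A x⁻¹)ᴴ * A x⁻¹
  have hA' : Continuous fun x : G => A x⁻¹ := hA.comp continuous_inv
  have hN : WeaklyContinuous N := fun l =>
    l.continuous_of_finiteDimensional.comp (hA'.matrix_conjTranspose.matrix_mul hA')
  obtain ⟨M, hM⟩ := hN.exists_integral (Measure.haarMeasure ⊤)
  refine ⟨M, ?_, fun g => ?_⟩
  · rw [← Matrix.mulVec_injective_iff_isUnit]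
    refine (injective_iff_map_eq_zero M.mulVecLin).2 fun v hv => ?_
    by_contra hv0
    have hpos := integral_sum_norm_mulVec_sq_pos (Measure.haarMeasure ⊤) hA' (x₀ := 1)
      (v := v) (by simpa using hv0)
    have hform := hM (dotProductBilin ℂ ℂ (star v) ∘ₗ (Matrix.mulVecBilin ℂ ℂ).flip v)
    have hMv : star v ⬝ᵥ (M *ᵥ v) = 0 := by rw [← M.mulVecLin_apply, hv, dotProduct_zero]
    simp only [LinearMap.comp_apply, LinearMap.flip_apply, Matrix.mulVecBilin_apply,
      dotProductBilin_apply_apply, hMv, N, star_dotProduct_conjTranspose_mul_self_mulVec,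
      integral_complex_ofReal] at hform
    exact hpos.ne (by exact_mod_cast hform)
  · ext i j
    have hentry := hM (Matrix.entryLinearMap ℂ ℂ i j ∘ₗ LinearMap.mulRight ℂ (A g) ∘ₗ
      LinearMap.mulLeft ℂ (A g)ᴴ)
    have htranslate (x : G) : (A g)ᴴ * N x * A g = N (g⁻¹ * x) := by
      simp only [N, mul_inv_rev, inv_inv, map_mul, Matrix.conjTranspose_mul, Matrix.mul_assoc]
    simp only [LinearMap.comp_apply, LinearMap.mulRight_apply, LinearMap.mulLeft_apply,
      htranslate, integral_mul_left_eq_self fun x => Matrix.entryLinearMap ℂ ℂ i j (N x),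
      ← hM] at hentry
    exact hentry

theorem trace_eq_conj_trace_of_conjTranspose_mul_mul_eq {B C M : Matrix n n ℂ} (hM : IsUnit M)
    (hB : Bᴴ * M * B = M) (hBC : B * C = 1) : C.trace = conj B.trace := by
  have hdet := (Matrix.isUnit_iff_isUnit_det _).1 hM
  have hconj : M * C * M⁻¹ = Bᴴ := by
    rw [← hB, Matrix.mul_assoc _ B, hBC, Matrix.mul_one, hB]
    exact Matrix.mul_nonsing_inv_cancel_right _ _ hdet
  rw [starRingEnd_apply, ← Matrix.trace_conjTranspose, ← hconj, Matrix.trace_mul_cycle,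
    Matrix.nonsing_inv_mul _ hdet, Matrix.one_mul]

theorem IsContinuousRep.character_inv {V : Type*} [AddCommGroup V] [Module ℂ V]
    [FiniteDimensional ℂ V] {ρ : Representation ℂ G V} (hρ : IsContinuousRep ρ) (g : G) :
    ρ.character g⁻¹ = conj (ρ.character g) := by
  let b := Module.finBasis ℂ V
  let A : G →* Matrix _ _ ℂ := (LinearMap.toMatrixAlgEquiv b).toAlgHom.toMonoidHom.comp ρ
  have hA : Continuous A := continuous_matrix fun i j => by
    simpa [A, LinearMap.toMatrixAlgEquiv_apply] using hρ (b j) (b.coord i)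
  have htrace (x : G) : ρ.character x = (A x).trace := LinearMap.trace_eq_matrix_trace ℂ b (ρ x)
  obtain ⟨M, hM, hinv⟩ := exists_isUnit_conjTranspose_mul_mul_eq A hA
  rw [htrace, htrace]
  exact trace_eq_conj_trace_of_conjTranspose_mul_mul_eq hM (hinv g)
    (by rw [← map_mul, mul_inv_cancel, map_one])

end InvariantForm

/-! ### Irreducible characters and character expansions -/

section Haar

variable {G V W : Type*} [Group G] [TopologicalSpace G] [IsTopologicalGroup G] [CompactSpace G]
  [MeasurableSpace G] [BorelSpace G] (μ : Measure G) [μ.IsHaarMeasure] [IsProbabilityMeasure μ]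
  [AddCommGroup V] [Module ℂ V] [FiniteDimensional ℂ V]
  [AddCommGroup W] [Module ℂ W] [FiniteDimensional ℂ W]
  {ρ : Representation ℂ G V} {σ : Representation ℂ G W}

theorem isMulRightInvariant_of_compactSpace : μ.IsMulRightInvariant where
  map_mul_right_eq_self g := by
    have : IsProbabilityMeasure (Measure.map (· * g) μ) :=
      Measure.isProbabilityMeasure_map (by fun_prop)
    exact Measure.isHaarMeasure_eq_of_isProbabilityMeasure _ _

theorem integral_character (hρ : IsContinuousRep ρ) :
    ∫ g, ρ.character g ∂μ = Module.finrank ℂ ρ.invariants := by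
  obtain ⟨P, hP⟩ := hρ.weaklyContinuous.exists_integral μ
  have hPv (v : V) (l : Module.Dual ℂ V) : l (P v) = ∫ g, l (ρ g v) ∂μ :=
    hP (l ∘ₗ LinearMap.applyₗ v)
  have hproj : LinearMap.IsProj ρ.invariants P := by
    constructor <;> refine fun v h => Module.eval_apply_injective ℂ (LinearMap.ext fun l => ?_)
    · change l (ρ h (P v)) = l (P v)
      rw [hPv, ← integral_mul_left_eq_self _ h]
      simpa using hPv v (l ∘ₗ ρ h)
    · change l (P v) = l v
      have hv : ∀ g, ρ g v = v := h
      simp [hPv, hv]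
  exact (hP (LinearMap.trace ℂ V)).symm.trans hproj.trace

theorem integral_character_inv_mul_character (hρ : IsContinuousRep ρ) (hσ : IsContinuousRep σ) :
    ∫ g, ρ.character g⁻¹ * σ.character g ∂μ = Module.finrank ℂ (ρ.IntertwiningMap σ) := by
  simp only [← Representation.char_linHom]
  rw [integral_character μ (hρ.linHom hσ),
    (Representation.invariantsEquivIntertwiningMap ρ σ).finrank_eq]

theorem integral_character_conj_mul (hρ : IsContinuousRep ρ) (hi : ρ.IsIrreducible) (α g : G) :
    ∫ h, ρ.character (h * α * h⁻¹ * g) ∂μ =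
      ρ.character α / Module.finrank ℂ V * ρ.character g := by
  obtain ⟨T, hT⟩ := (hρ.weaklyContinuous.comp_continuous
    (show Continuous fun h => h * α * h⁻¹ by fun_prop)).exists_integral μ
  have hcomm (x : G) : T ∘ₗ ρ x = ρ x ∘ₗ T := by
    refine Module.eval_apply_injective ℂ (LinearMap.ext fun l => ?_)
    have hright := hT (l ∘ₗ LinearMap.lcomp ℂ V (ρ x))
    have hleft := hT (l ∘ₗ LinearMap.llcomp ℂ V V V (ρ x))
    rw [← integral_mul_left_eq_self _ x] at hright
    refine hright.trans ((integral_congr_ae (.of_forall fun h => ?_)).trans hleft.symm)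
    change l (ρ _ * ρ x) = l (ρ x * ρ _)
    rw [← map_mul, ← map_mul]
    congr 2
    group
  obtain ⟨c, rfl⟩ := exists_eq_smul_id_of_commute hi hcomm
  have hdim : (Module.finrank ℂ V : ℂ) ≠ 0 := by
    have := (isIrreducible_iff.1 hi).1
    exact_mod_cast Module.finrank_pos.ne'
  have hc : c * Module.finrank ℂ V = ρ.character α := by
    have htrace := hT (LinearMap.trace ℂ V)
    simp only [← Representation.character.eq_def, Representation.char_conj] at htrace
    simpa using htrace
  have hmul (h : G) : ρ.character (h * α * h⁻¹ * g) =
      (LinearMap.trace ℂ V ∘ₗ LinearMap.lcomp ℂ V (ρ g)) (ρ (h * α * h⁻¹)) :=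
    congrArg (LinearMap.trace ℂ V) (map_mul ρ _ g)
  simp only [hmul]
  rw [← hT, ← hc, mul_div_cancel_right₀ _ hdim, map_smul, smul_eq_mul]
  rfl

end Haar

section Decomposition

variable {G V : Type*} [Group G] [TopologicalSpace G] [AddCommGroup V] [Module ℂ V]
  [FiniteDimensional ℂ V] {σ : Representation ℂ G V}

theorem exists_irrep_equiv (hσ : IsContinuousRep σ) (hi : σ.IsIrreducible) :
    ∃ φ : Irrep G, Nonempty (σ.Equiv φ.rep) := by
  let e : V ≃ₗ[ℂ] (Fin (Module.finrank ℂ V) → ℂ) := (Module.finBasis ℂ V).equivFun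
  let ρ : Representation ℂ G (Fin (Module.finrank ℂ V) → ℂ) :=
    (e.conjRingEquiv : _ →* _).comp σ
  let E : σ.Equiv ρ := .mk e fun g => by
    ext v i
    simp [ρ, LinearEquiv.conjRingEquiv]
  exact ⟨⟨_, ρ, hσ.of_equiv E, isIrreducible_of_equiv E hi⟩, ⟨E⟩⟩

namespace IrrepClass

/-- The isomorphism class of an irreducible representation. -/
def mk (φ : Irrep G) : IrrepClass G := Quotient.mk _ φ

theorem nonempty_equiv_out_mk (φ : Irrep G) : Nonempty ((mk φ).out.rep.Equiv φ.rep) :=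
  Quotient.mk_out φ

theorem character_mk (φ : Irrep G) : (mk φ).character = φ.rep.character :=
  Representation.char_iso (nonempty_equiv_out_mk φ).some

theorem nonempty_equiv_iff {φ ψ : IrrepClass G} :
    Nonempty (φ.out.rep.Equiv ψ.out.rep) ↔ φ = ψ :=
  Quotient.out_equiv_out (s := irrepSetoid G)

theorem nontrivial_out (φ : IrrepClass G) : Nontrivial (Fin φ.out.n → ℂ) :=
  (isIrreducible_iff.1 φ.out.irreducible_rep).1

theorem continuous_character (φ : IrrepClass G) : Continuous φ.character :=
  φ.out.continuous_rep.continuous_character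

theorem character_one (φ : IrrepClass G) : φ.character 1 = φ.dim := by
  simp [character, dim]

end IrrepClass

open IrrepClass in
theorem exists_linearCombination_character_eq (hσ : IsContinuousRep σ) :
    ∃ r : IrrepClass G →₀ ℝ, σ.character = Finsupp.linearCombination ℝ character r := by
  induction hn : Module.finrank ℂ V using Nat.strong_induction_on generalizing V with
  | _ n ih =>
    subst hn
    by_cases hi : σ.IsIrreducible
    · obtain ⟨φ, ⟨e⟩⟩ := exists_irrep_equiv hσ hi
      exact ⟨.single (mk φ) 1, by simp [character_mk, Representation.char_iso e]⟩
    rcases subsingleton_or_nontrivial V with hV | hV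
    · refine ⟨0, funext fun g => ?_⟩
      simp [Representation.character, Subsingleton.elim (σ g) 0]
    obtain ⟨U, hU, hbot, htop⟩ :
        ∃ U : Submodule ℂ V, (∀ g, U ≤ U.comap (σ g)) ∧ U ≠ ⊥ ∧ U ≠ ⊤ := by
      simpa [isIrreducible_iff, hV] using hi
    have hquot : Module.finrank ℂ (V ⧸ U) < Module.finrank ℂ V := by
      have := Submodule.one_le_finrank_iff.2 hbot
      have := U.finrank_quotient_add_finrank
      omega
    obtain ⟨r, hr⟩ := ih _ (Submodule.finrank_lt htop) (hσ.subrepresentation U hU) rfl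
    obtain ⟨s, hs⟩ := ih _ hquot (hσ.quotient U hU) rfl
    exact ⟨r + s, by rw [character_eq_subrepresentation_add_quotient U hU, hr, hs, map_add]⟩

end Decomposition

namespace IrrepClass

variable {G : Type*} [Group G] [TopologicalSpace G]

section Trivial

variable (G) in
/-- The trivial representation on the line. -/
def trivIrrep : Irrep G where
  n := 1
  rep := Representation.trivial ℂ G (Fin 1 → ℂ)
  continuous_rep v l := by simpa using continuous_const
  irreducible_rep := isIrreducible_iff.2 ⟨inferInstance, fun U _ => by
    have : IsSimpleOrder (Submodule ℂ (Fin 1 → ℂ)) := by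
      rw [← isSimpleModule_iff, isSimpleModule_iff_finrank_eq_one]
      simp
    exact eq_bot_or_eq_top U⟩

variable (G) in
/-- The class of the trivial representation on the line, the constant term of a character
expansion. -/
def triv : IrrepClass G := mk (trivIrrep G)

theorem character_triv : (triv G).character = 1 := by
  rw [triv, character_mk]
  exact funext fun _ => (LinearMap.trace_id ℂ (Fin 1 → ℂ)).trans (by simp)

theorem isTrivial_triv : (triv G).IsTrivial := by
  obtain ⟨e⟩ := nonempty_equiv_out_mk (trivIrrep G)
  refine ⟨fun g => LinearMap.ext fun v => e.toLinearEquiv.injective ?_⟩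
  exact e.toIntertwiningMap.isIntertwining _ _ g v

theorem isTrivial_iff {φ : IrrepClass G} : φ.IsTrivial ↔ φ = triv G := by
  refine ⟨fun h => ?_, fun h => h ▸ isTrivial_triv⟩
  have := φ.nontrivial_out
  have := (triv G).nontrivial_out
  have := φ.out.irreducible_rep
  have := (triv G).out.irreducible_rep
  obtain ⟨T, hT⟩ := exists_ne (0 : (Fin φ.out.n → ℂ) →ₗ[ℂ] (Fin (triv G).out.n → ℂ))
  let f : φ.out.rep.IntertwiningMap (triv G).out.rep :=
    ⟨T, fun g => by rw [h.out, isTrivial_triv.out]; rfl⟩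
  have hf : Function.Bijective f :=
    (Representation.IsIrreducible.bijective_or_eq_zero f).resolve_right fun h0 =>
      hT (congrArg Representation.IntertwiningMap.toLinearMap h0)
  exact nonempty_equiv_iff.1 ⟨f.ofBijective hf⟩

end Trivial

/-- The ratio `χ^φ(α) / dim φ` by which averaging over the conjugates of `α` acts on the character
`χ^φ`. It is used for `α` conjugate to `α⁻¹`, when `χ^φ(α)` is real. -/
def characterRatio (α : G) (φ : IrrepClass G) : ℝ := (φ.character α).re / φ.dim

theorem characterRatio_triv (α : G) : characterRatio α (triv G) = 1 := by
  have hdim := character_one (triv G)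
  rw [character_triv, Pi.one_apply] at hdim
  rw [characterRatio, ← Complex.ofReal_inj]
  simp [character_triv, ← hdim]

variable [IsTopologicalGroup G] [CompactSpace G]

open scoped ComplexConjugate in
theorem character_inv (φ : IrrepClass G) (g : G) : φ.character g⁻¹ = conj (φ.character g) :=
  φ.out.continuous_rep.character_inv g

theorem character_im_eq_zero (φ : IrrepClass G) {α : G} (hα : IsConj α α⁻¹) :
    (φ.character α).im = 0 := by
  obtain ⟨k, hk⟩ := isConj_iff.1 hα
  have h : φ.character α⁻¹ = φ.character α := by
    rw [← hk]
    exact Representation.char_conj _ _ _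
  rw [φ.character_inv] at h
  exact Complex.conj_eq_iff_im.1 h

theorem ofReal_characterRatio (φ : IrrepClass G) {α : G} (hα : IsConj α α⁻¹) :
    (characterRatio α φ : ℂ) = φ.character α / φ.dim := by
  rw [characterRatio, Complex.ofReal_div, Complex.ofReal_natCast,
    Complex.conj_eq_iff_re.1 (Complex.conj_eq_iff_im.2 (φ.character_im_eq_zero hα))]

variable [MeasurableSpace G] [BorelSpace G]
  (μ : Measure G) [μ.IsHaarMeasure] [IsProbabilityMeasure μ]

open scoped Classical in
theorem integral_character_inv_mul_character (φ ψ : IrrepClass G) :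
    ∫ g, φ.character g⁻¹ * ψ.character g ∂μ = if φ = ψ then 1 else 0 := by
  have := φ.out.irreducible_rep
  have := ψ.out.irreducible_rep
  refine (CompactLieCLT.integral_character_inv_mul_character μ φ.out.continuous_rep
    ψ.out.continuous_rep).trans ?_
  split_ifs with h
  · subst h
    rw [Representation.IsIrreducible.finrank_intertwiningMap_self, Nat.cast_one]
  · have : IsEmpty (φ.out.rep.Equiv ψ.out.rep) := by
      rwa [← not_nonempty_iff, nonempty_equiv_iff]
    rw [Module.finrank_zero_of_subsingleton, Nat.cast_zero]

theorem integral_character_conj_mul (φ : IrrepClass G) {α : G} (hα : IsConj α α⁻¹) (g : G) :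
    ∫ h, φ.character (h * α * h⁻¹ * g) ∂μ = characterRatio α φ * φ.character g := by
  rw [φ.ofReal_characterRatio hα, dim, ← Module.finrank_fin_fun ℂ (n := φ.out.n)]
  exact CompactLieCLT.integral_character_conj_mul μ φ.out.continuous_rep φ.out.irreducible_rep α g

end IrrepClass

section LinearCombination

variable {G : Type*} [Group G] [TopologicalSpace G]

open IrrepClass Finsupp

theorem linearCombination_character_apply {r : IrrepClass G →₀ ℝ} {S : Finset (IrrepClass G)}
    (hS : r.support ⊆ S) (g : G) :
    linearCombination ℝ character r g = ∑ φ ∈ S, (r φ : ℂ) * φ.character g := by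
  rw [linearCombination_apply, Finsupp.sum_of_support_subset r hS _ (by simp), Finset.sum_apply]
  simp

theorem continuous_linearCombination_character (r : IrrepClass G →₀ ℝ) :
    Continuous (linearCombination ℝ character r) := by
  induction r using Finsupp.induction_linear with
  | zero => simpa using continuous_zero
  | add r s hr hs => simpa using hr.add hs
  | single φ c => simpa using φ.continuous_character.const_smul c

variable [IsTopologicalGroup G] [CompactSpace G]

open scoped ComplexConjugate in
theorem linearCombination_character_inv (r : IrrepClass G →₀ ℝ) (g : G) :
    linearCombination ℝ character r g⁻¹ = conj (linearCombination ℝ character r g) := by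
  induction r using Finsupp.induction_linear with
  | zero => simp
  | add r s hr hs => simp [hr, hs]
  | single φ c => simp [φ.character_inv]

variable [MeasurableSpace G] [BorelSpace G]
  (μ : Measure G) [μ.IsHaarMeasure] [IsProbabilityMeasure μ]

theorem integral_character_inv_mul_linearCombination (φ : IrrepClass G) (r : IrrepClass G →₀ ℝ) :
    ∫ g, φ.character g⁻¹ * linearCombination ℝ character r g ∂μ = r φ := by
  classical
  induction r using Finsupp.induction_linear with
  | zero => simp
  | add r s hr hs =>
    have hint (t : IrrepClass G →₀ ℝ) :
        Integrable (fun g => φ.character g⁻¹ * linearCombination ℝ character t g) μ :=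
      integrable_of_continuous ((φ.continuous_character.comp continuous_inv).mul
        (continuous_linearCombination_character t))
    simp only [map_add, Pi.add_apply, mul_add]
    rw [integral_add (hint r) (hint s), hr, hs, Finsupp.add_apply, Complex.ofReal_add]
  | single ψ c =>
    simp only [linearCombination_single, Pi.smul_apply, Complex.real_smul, mul_left_comm _ (c : ℂ)]
    rw [integral_const_mul, φ.integral_character_inv_mul_character μ, Finsupp.single_apply]
    split_ifs <;> simp_all

theorem integral_linearCombination_inv_mul_linearCombination (r s : IrrepClass G →₀ ℝ) :
    ∫ g, linearCombination ℝ character r g⁻¹ * linearCombination ℝ character s g ∂μ =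
      ∑ φ ∈ r.support, (r φ * s φ : ℝ) := by
  have hint (φ : IrrepClass G) : Integrable
      (fun g => (r φ : ℂ) * (φ.character g⁻¹ * linearCombination ℝ character s g)) μ :=
    integrable_of_continuous (continuous_const.mul
      ((φ.continuous_character.comp continuous_inv).mul
        (continuous_linearCombination_character s)))
  simp only [linearCombination_character_apply (subset_refl r.support), Finset.sum_mul, mul_assoc]
  rw [integral_finsetSum _ fun φ _ => hint φ]
  simp [integral_const_mul, integral_character_inv_mul_linearCombination]

theorem integral_linearCombination_character_conj_mul (r : IrrepClass G →₀ ℝ) {α : G}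
    (hα : IsConj α α⁻¹) (g : G) :
    ∫ h, linearCombination ℝ character r (h * α * h⁻¹ * g) ∂μ =
      linearCombination ℝ character (characterRatio α • r) g := by
  have hint (φ : IrrepClass G) :
      Integrable (fun h => (r φ : ℂ) * φ.character (h * α * h⁻¹ * g)) μ :=
    integrable_of_continuous (continuous_const.mul (φ.continuous_character.comp (by fun_prop)))
  have hsupp : (characterRatio α • r).support ⊆ r.support := fun φ hφ => by
    rw [Finsupp.mem_support_iff, Finsupp.coe_pointwise_smul] at hφ
    exact Finsupp.mem_support_iff.2 (right_ne_zero_of_mul hφ)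
  rw [linearCombination_character_apply hsupp]
  simp only [linearCombination_character_apply (subset_refl r.support)]
  rw [integral_finsetSum _ fun φ _ => hint φ]
  refine Finset.sum_congr rfl fun φ _ => ?_
  rw [integral_const_mul, φ.integral_character_conj_mul μ hα, Finsupp.coe_pointwise_smul]
  simp only [Pi.smul_apply', smul_eq_mul, Complex.ofReal_mul]
  ring

end LinearCombination

theorem exists_linearCombination_mult_eq {G V : Type*} [Group G] [TopologicalSpace G]
    [IsTopologicalGroup G] [CompactSpace G] [AddCommGroup V] [Module ℂ V] [FiniteDimensional ℂ V]
    {σ : Representation ℂ G V} (hσ : IsContinuousRep σ) : ∃ r : IrrepClass G →₀ ℝ,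
      (∀ φ, r φ = φ.mult σ) ∧ σ.character = Finsupp.linearCombination ℝ IrrepClass.character r := by
  borelize G
  have : IsProbabilityMeasure (Measure.haarMeasure (⊤ : TopologicalSpace.PositiveCompacts G)) :=
    ⟨Measure.haarMeasure_self⟩
  obtain ⟨r, hr⟩ := exists_linearCombination_character_eq hσ
  refine ⟨r, fun φ => Complex.ofReal_injective ?_, hr⟩
  have hcoeff := integral_character_inv_mul_linearCombination (Measure.haarMeasure ⊤) φ r
  rw [← hr] at hcoeff
  exact hcoeff.symm.trans (integral_character_inv_mul_character _ φ.out.continuous_rep hσ)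

section CharacterExpansion

variable {G : Type*} [Group G] [TopologicalSpace G]

/-- `F = ∑ φ, r φ • χ^φ`: the real-valued function `F` is a finite combination of irreducible
characters with real coefficients `r`. -/
def HasCharacterExpansion (F : G → ℝ) (r : IrrepClass G →₀ ℝ) : Prop :=
  ∀ g, (F g : ℂ) = Finsupp.linearCombination ℝ IrrepClass.character r g

namespace HasCharacterExpansion

variable {F H : G → ℝ} {r s : IrrepClass G →₀ ℝ}

theorem const (c : ℝ) : HasCharacterExpansion (fun _ : G => c) (.single (IrrepClass.triv G) c) :=
  fun g => by simp [IrrepClass.character_triv]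

theorem add (hF : HasCharacterExpansion F r) (hH : HasCharacterExpansion H s) :
    HasCharacterExpansion (fun g => F g + H g) (r + s) := fun g => by simp [hF g, hH g]

theorem sub (hF : HasCharacterExpansion F r) (hH : HasCharacterExpansion H s) :
    HasCharacterExpansion (fun g => F g - H g) (r - s) := fun g => by simp [hF g, hH g]

theorem const_mul (c : ℝ) (hF : HasCharacterExpansion F r) :
    HasCharacterExpansion (fun g => c * F g) (c • r) := fun g => by simp [hF g]

variable [IsTopologicalGroup G] [CompactSpace G] [MeasurableSpace G] [BorelSpace G]
  (μ : Measure G) [μ.IsHaarMeasure] [IsProbabilityMeasure μ]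

theorem integral_mul (hF : HasCharacterExpansion F r) (hH : HasCharacterExpansion H s) :
    ∫ g, F g * H g ∂μ = ∑ᶠ φ, r φ * s φ := by
  have hsupp : Function.support (fun φ => r φ * s φ) ⊆ r.support := fun φ hφ =>
    Finsupp.mem_support_iff.2 (left_ne_zero_of_mul hφ)
  rw [finsum_eq_sum_of_support_subset _ hsupp, ← Complex.ofReal_inj, ← integral_complex_ofReal]
  have hinv (g : G) : (F g : ℂ) = Finsupp.linearCombination ℝ IrrepClass.character r g⁻¹ := by
    rw [linearCombination_character_inv, ← hF g, Complex.conj_ofReal]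
  simp only [Complex.ofReal_mul, hinv, hH _]
  rw [integral_linearCombination_inv_mul_linearCombination, Complex.ofReal_sum]

theorem integral_eq (hF : HasCharacterExpansion F r) : ∫ g, F g ∂μ = r (IrrepClass.triv G) := by
  have hmul := (const 1).integral_mul μ hF
  rw [finsum_eq_single _ (IrrepClass.triv G) fun φ hφ => by simp [hφ.symm]] at hmul
  simpa using hmul

theorem integral_conj_mul (hF : HasCharacterExpansion F r) {α : G} (hα : IsConj α α⁻¹) :
    HasCharacterExpansion (fun g => ∫ h, F (h * α * h⁻¹ * g) ∂μ)
      (IrrepClass.characterRatio α • r) := fun g => by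
  rw [← integral_complex_ofReal, ← integral_linearCombination_character_conj_mul μ r hα]
  simp only [hF _]

end HasCharacterExpansion

end CharacterExpansion

/-! ### Multiplication by a random conjugate -/

section ConditionalExpectation

variable {X Y : Type*} [MeasurableSpace X] [MeasurableSpace Y] {μ : Measure X} {ν : Measure Y}
  [IsFiniteMeasure μ] [IsProbabilityMeasure ν]

theorem condExp_comap_fst_prod_ae_eq {F : X × Y → ℝ} (hF : Integrable F (μ.prod ν)) :
    (μ.prod ν)[F|MeasurableSpace.comap Prod.fst inferInstance] =ᵐ[μ.prod ν]
      fun p => ∫ y, F (p.1, y) ∂ν := by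
  have hG : Integrable (fun x => ∫ y, F (x, y) ∂ν) μ := hF.integral_prod_left
  have hG' : Integrable (fun p : X × Y => ∫ y, F (p.1, y) ∂ν) (μ.prod ν) := hG.comp_fst ν
  refine (ae_eq_condExp_of_forall_setIntegral_eq measurable_fst.comap_le hF
    (fun s _ _ => hG'.integrableOn) ?_ ?_).symm
  · rintro _ ⟨t, -, rfl⟩ -
    rw [← prod_univ, setIntegral_prod _ hG'.integrableOn, setIntegral_prod _ hF.integrableOn]
    simp
  · refine AEStronglyMeasurable.comp_ae_measurable' (f := fun x => ∫ y, F (x, y) ∂ν) ?_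
      measurable_fst.aemeasurable
    simpa [Measure.map_fst_prod] using hG.aestronglyMeasurable

end ConditionalExpectation

section RandomConjugate

variable {G : Type*} [Group G] [TopologicalSpace G] [IsTopologicalGroup G] [CompactSpace G]
  [MeasurableSpace G] [BorelSpace G] {μ : Measure G} [μ.IsHaarMeasure] [IsProbabilityMeasure μ]
  {w : G → ℝ} {α : G} {a : ℝ} {r : IrrepClass G →₀ ℝ}

theorem identDistrib_conj_mul_swap (hw : Measurable w)
    (hwα : Measurable fun p : G × G => w (p.2 * α * p.2⁻¹ * p.1)) (hα : IsConj α α⁻¹) :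
    IdentDistrib (fun p : G × G => (w p.1, w (p.2 * α * p.2⁻¹ * p.1)))
      (fun p => (w (p.2 * α * p.2⁻¹ * p.1), w p.1)) (μ.prod μ) (μ.prod μ) := by
  obtain ⟨k, hk⟩ := isConj_iff.1 hα
  have := isMulRightInvariant_of_compactSpace μ
  have hw₁ : Measurable fun p : G × G => w p.1 := hw.comp measurable_fst
  refine ⟨(hw₁.prodMk hwα).aemeasurable, (hwα.prodMk hw₁).aemeasurable, Measure.ext fun s hs => ?_⟩
  rw [Measure.map_apply (hw₁.prodMk hwα) hs, Measure.map_apply (hwα.prodMk hw₁) hs,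
    Measure.prod_apply_symm (hw₁.prodMk hwα hs), Measure.prod_apply_symm (hwα.prodMk hw₁ hs)]
  have htranslate (h : G) : μ {g | (w g, w (h * α * h⁻¹ * g)) ∈ s} =
      μ {g | (w (h * k * α * (h * k)⁻¹ * g), w g) ∈ s} := by
    rw [← measure_preimage_mul μ (h * α * h⁻¹) {g | (w (h * k * α * (h * k)⁻¹ * g), w g) ∈ s}]
    congr 1
    ext g
    have hcancel : h * k * α * (h * k)⁻¹ * (h * α * h⁻¹ * g) = g := by
      rw [show h * k * α * (h * k)⁻¹ = h * (k * α * k⁻¹) * h⁻¹ by group, hk]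
      group
    simp only [mem_preimage, mem_ofPred_eq, hcancel]
  exact (lintegral_congr htranslate).trans
    (lintegral_mul_right_eq_self (fun h => μ {g | (w (h * α * h⁻¹ * g), w g) ∈ s}) k)

theorem isSteinPair_conj_mul (hw : Continuous w)
    (hwα : Measurable fun p : G × G => w (p.2 * α * p.2⁻¹ * p.1)) (hα : IsConj α α⁻¹)
    (hmean : ∀ g, ∫ h, w (h * α * h⁻¹ * g) ∂μ = (1 - a) * w g) :
    IsSteinPair (MeasurableSpace.comap Prod.fst inferInstance) (μ.prod μ)
      (fun p : G × G => w p.1) (fun p => w (p.2 * α * p.2⁻¹ * p.1)) a where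
  le := measurable_fst.comap_le
  stronglyMeasurable :=
    (hw.measurable.comp (comap_measurable Prod.fst)).stronglyMeasurable
  memLp := by
    obtain ⟨C, hC⟩ := hw.bounded_above_of_compact_support (.of_compactSpace w)
    exact MemLp.of_bound (hw.measurable.comp measurable_fst).aestronglyMeasurable C
      (.of_forall fun p => hC p.1)
  identDistrib := identDistrib_conj_mul_swap hw.measurable hwα hα
  condExp_ae_eq := by
    obtain ⟨C, hC⟩ := hw.bounded_above_of_compact_support (.of_compactSpace w)
    have hint : Integrable (fun p : G × G => w (p.2 * α * p.2⁻¹ * p.1)) (μ.prod μ) :=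
      .of_bound hwα.aestronglyMeasurable C (.of_forall fun p => hC _)
    exact (condExp_comap_fst_prod_ae_eq hint).trans (.of_forall fun p => hmean p.1)

theorem integral_sq_sub_conj_mul (hw : Continuous w)
    (hmean : ∀ g, ∫ h, w (h * α * h⁻¹ * g) ∂μ = (1 - a) * w g) (g : G) :
    ∫ h, (w (h * α * h⁻¹ * g) - w g) ^ 2 ∂μ =
      (∫ h, w (h * α * h⁻¹ * g) ^ 2 ∂μ) + (2 * a - 1) * w g ^ 2 := by
  have hint {F : G → ℝ} (hF : Continuous F) : Integrable F μ :=
    hF.integrable_of_hasCompactSupport (.of_compactSpace F)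
  simp only [sub_sq, mul_right_comm 2 _ (w g)]
  rw [integral_add (hint (by fun_prop)) (hint (by fun_prop)),
    integral_sub (hint (by fun_prop)) (hint (by fun_prop)), integral_const_mul, hmean,
    integral_const, probReal_univ, one_smul]
  ring

theorem integral_sq_two_sub_condVar_eq_finsum (hw : Continuous w) (hα : IsConj α α⁻¹)
    (hmean : ∀ g, ∫ h, w (h * α * h⁻¹ * g) ∂μ = (1 - a) * w g)
    (hr : HasCharacterExpansion (fun g => w g ^ 2) r) (hvar : ∫ g, w g ^ 2 ∂μ = 1) (ha0 : a ≠ 0) :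
    ∫ g, (2 - (∫ h, (w (h * α * h⁻¹ * g) - w g) ^ 2 ∂μ) / a) ^ 2 ∂μ =
      ∑ᶠ (φ : IrrepClass G) (_ : ¬ φ.IsTrivial),
        r φ ^ 2 * (2 - 1 / a * (1 - IrrepClass.characterRatio α φ)) ^ 2 := by
  have hD := (HasCharacterExpansion.const (G := G) 2).sub
    (((hr.integral_conj_mul μ hα).add (hr.const_mul (2 * a - 1))).const_mul a⁻¹)
  have htriv : r (IrrepClass.triv G) = 1 := (hr.integral_eq μ).symm.trans hvar
  have hsquare := hD.integral_mul μ hD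
  simp only [← sq, ← integral_sq_sub_conj_mul hw hmean, inv_mul_eq_div] at hsquare
  refine hsquare.trans (finsum_congr fun φ => ?_)
  simp only [Finsupp.sub_apply, Finsupp.add_apply, Finsupp.smul_apply, Finsupp.coe_pointwise_smul,
    Pi.smul_apply', smul_eq_mul, IrrepClass.isTrivial_iff]
  by_cases hφ : φ = IrrepClass.triv G
  · subst hφ
    simp only [not_true_eq_false, finsum_false, Finsupp.single_eq_same, htriv,
      IrrepClass.characterRatio_triv]
    field_simp
    ring
  · simp only [hφ, not_false_eq_true, finsum_true, Finsupp.single_eq_of_ne hφ]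
    field_simp
    ring

theorem integral_pow_four_sub_conj_mul_div (hw : Continuous w)
    (hwα : Measurable fun p : G × G => w (p.2 * α * p.2⁻¹ * p.1)) (hα : IsConj α α⁻¹)
    (hmean : ∀ g, ∫ h, w (h * α * h⁻¹ * g) ∂μ = (1 - a) * w g) (ha0 : a ≠ 0) :
    (∫ p : G × G, (w (p.2 * α * p.2⁻¹ * p.1) - w p.1) ^ 4 ∂μ.prod μ) / a =
      ∫ g, w g ^ 2 * ((8 - 6 / a) * w g ^ 2 + 6 / a * ∫ h, w (h * α * h⁻¹ * g) ^ 2 ∂μ) ∂μ := by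
  have hpair := isSteinPair_conj_mul hw hwα hα hmean
  have hint := hpair.integrable_pow_mul_pow (i := 2) (j := 2) le_rfl
  have hfourth : ∫ p : G × G, w p.1 ^ 4 ∂μ.prod μ = ∫ g, w g ^ 2 * w g ^ 2 ∂μ := by
    simp only [integral_fun_fst (fun g => w g ^ 4), probReal_univ, one_smul, ← pow_add,
      Nat.reduceAdd]
  have hcross : ∫ p : G × G, w p.1 ^ 2 * w (p.2 * α * p.2⁻¹ * p.1) ^ 2 ∂μ.prod μ =
      ∫ g, w g ^ 2 * ∫ h, w (h * α * h⁻¹ * g) ^ 2 ∂μ ∂μ := by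
    rw [integral_prod _ hint]
    simp only [integral_const_mul]
  have hint₁ : Integrable (fun g => w g ^ 2 * w g ^ 2) μ :=
    (show Continuous _ by fun_prop).integrable_of_hasCompactSupport (.of_compactSpace _)
  have hint₂ : Integrable (fun g => w g ^ 2 * ∫ h, w (h * α * h⁻¹ * g) ^ 2 ∂μ) μ := by
    simpa only [integral_const_mul] using hint.integral_prod_left
  rw [hpair.integral_pow_four_sub, hfourth, hcross]
  simp only [mul_add, mul_left_comm (_ ^ 2)]
  rw [integral_add (hint₁.const_mul _) (hint₂.const_mul _), integral_const_mul,
    integral_const_mul]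
  field_simp

theorem integral_pow_four_sub_conj_mul_div_eq_finsum (hw : Continuous w)
    (hwα : Measurable fun p : G × G => w (p.2 * α * p.2⁻¹ * p.1)) (hα : IsConj α α⁻¹)
    (hmean : ∀ g, ∫ h, w (h * α * h⁻¹ * g) ∂μ = (1 - a) * w g)
    (hr : HasCharacterExpansion (fun g => w g ^ 2) r) (ha0 : a ≠ 0) :
    (∫ p : G × G, (w (p.2 * α * p.2⁻¹ * p.1) - w p.1) ^ 4 ∂μ.prod μ) / a =
      ∑ᶠ φ, r φ ^ 2 * (8 - 6 / a * (1 - IrrepClass.characterRatio α φ)) := by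
  rw [integral_pow_four_sub_conj_mul_div hw hwα hα hmean ha0, hr.integral_mul μ
    ((hr.const_mul (8 - 6 / a)).add ((hr.integral_conj_mul μ hα).const_mul (6 / a)))]
  refine finsum_congr fun φ => ?_
  simp only [Finsupp.add_apply, Finsupp.smul_apply, Finsupp.coe_pointwise_smul, Pi.smul_apply',
    smul_eq_mul]
  ring

theorem abs_measureReal_le_sub_gaussianReal_std_le_of_hasCharacterExpansion (hw : Continuous w)
    (hwα : Measurable fun p : G × G => w (p.2 * α * p.2⁻¹ * p.1)) (hα : IsConj α α⁻¹)
    (hmean : ∀ g, ∫ h, w (h * α * h⁻¹ * g) ∂μ = (1 - a) * w g)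
    (hr : HasCharacterExpansion (fun g => w g ^ 2) r) (hvar : ∫ g, w g ^ 2 ∂μ = 1) (ha0 : a ≠ 0)
    (x₀ : ℝ) :
    |μ.real {g | w g ≤ x₀} - (gaussianReal 0 1).real (Iic x₀)| ≤
      √(∑ᶠ (φ : IrrepClass G) (_ : ¬ φ.IsTrivial),
        r φ ^ 2 * (2 - 1 / a * (1 - IrrepClass.characterRatio α φ)) ^ 2) +
      (1 / Real.pi * ∑ᶠ φ, r φ ^ 2 * (8 - 6 / a * (1 - IrrepClass.characterRatio α φ))) ^
        (1 / 4 : ℝ) := by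
  have hpair := isSteinPair_conj_mul hw hwα hα hmean
  have hlaw : μ.real {g | w g ≤ x₀} = (μ.prod μ).real {p : G × G | w p.1 ≤ x₀} :=
    (measurePreserving_fst.measureReal_preimage
      (hw.measurable measurableSet_Iic).nullMeasurableSet).symm
  have hvar' : ∫ p : G × G, w p.1 ^ 2 ∂μ.prod μ = 1 := by
    rw [integral_fun_fst (fun g => w g ^ 2), probReal_univ, one_smul, hvar]
  have hcond := condExp_comap_fst_prod_ae_eq (hpair.memLp_sq_sub.integrable (by norm_num))
  have hsum : ∫ p, (2 - ((μ.prod μ)[fun p : G × G => (w (p.2 * α * p.2⁻¹ * p.1) - w p.1) ^ 2|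
      MeasurableSpace.comap Prod.fst inferInstance]) p / a) ^ 2 ∂μ.prod μ =
      ∑ᶠ (φ : IrrepClass G) (_ : ¬ φ.IsTrivial),
        r φ ^ 2 * (2 - 1 / a * (1 - IrrepClass.characterRatio α φ)) ^ 2 := by
    rw [← integral_sq_two_sub_condVar_eq_finsum hw hα hmean hr hvar ha0]
    rw [← one_smul ℝ (∫ g, _ ∂μ), ← probReal_univ (μ := μ), ← integral_fun_fst]
    exact integral_congr_ae (hcond.mono fun p hp => by simp only [hp])
  rw [hlaw, ← hsum, ← integral_pow_four_sub_conj_mul_div_eq_finsum hw hwα hα hmean hr ha0]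
  exact hpair.abs_measureReal_le_sub_gaussianReal_std_le_of_variance_eq_one hvar' ha0 x₀

theorem finsum_sq_mul_characterRatio_nonneg (hw : Continuous w)
    (hwα : Measurable fun p : G × G => w (p.2 * α * p.2⁻¹ * p.1)) (hα : IsConj α α⁻¹)
    (hmean : ∀ g, ∫ h, w (h * α * h⁻¹ * g) ∂μ = (1 - a) * w g)
    (hr : HasCharacterExpansion (fun g => w g ^ 2) r) (hvar : ∫ g, w g ^ 2 ∂μ = 1) (ha0 : a ≠ 0) :
    0 ≤ ∑ᶠ φ, r φ ^ 2 * (8 - 6 / a * (1 - IrrepClass.characterRatio α φ)) := by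
  have hvar' : ∫ p : G × G, w p.1 ^ 2 ∂μ.prod μ = 1 := by
    rw [integral_fun_fst (fun g => w g ^ 2), probReal_univ, one_smul, hvar]
  have ha := (isSteinPair_conj_mul hw hwα hα hmean).pos_of_ne_zero hvar' ha0
  rw [← integral_pow_four_sub_conj_mul_div_eq_finsum hw hwα hα hmean hr ha0]
  exact div_nonneg (integral_nonneg fun p => by positivity) ha.le

end RandomConjugate

section RealCharacter

variable {G V : Type*} [Group G] [AddCommGroup V] [Module ℂ V] {τ : Representation ℂ G V}

theorem ofReal_re_character (hreal : ∀ g : G, (τ.character g).im = 0) (g : G) :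
    ((τ.character g).re : ℂ) = τ.character g :=
  Complex.conj_eq_iff_re.1 (Complex.conj_eq_iff_im.2 (hreal g))

variable [TopologicalSpace G] [FiniteDimensional ℂ V]

theorem exists_hasCharacterExpansion_sq_re_character [IsTopologicalGroup G] [CompactSpace G]
    (hτ : IsContinuousRep τ) (hreal : ∀ g : G, (τ.character g).im = 0) :
    ∃ r : IrrepClass G →₀ ℝ, (∀ φ, r φ = φ.mult (τ.tprod τ)) ∧
      HasCharacterExpansion (fun g => (τ.character g).re ^ 2) r := by
  obtain ⟨r, hmult, hr⟩ := exists_linearCombination_mult_eq (hτ.tprod hτ)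
  refine ⟨r, hmult, fun g => ?_⟩
  rw [← hr, Representation.char_tensor, Complex.ofReal_pow, ofReal_re_character hreal, sq]
  rfl

variable [MeasurableSpace G] [BorelSpace G]

theorem IsContinuousRep.measurable_character_conj_mul [IsTopologicalGroup G]
    (hτ : IsContinuousRep τ) (α : G) :
    Measurable fun p : G × G => τ.character (p.2 * α * p.2⁻¹ * p.1) := by
  have h := (hτ.weaklyContinuous.comp_continuous (p := fun h => h * α * h⁻¹)
    (by fun_prop)).measurable_map₂ hτ.weaklyContinuous
    ((LinearMap.mul ℂ _).compr₂ (LinearMap.trace ℂ V))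
  simp only [Representation.character, map_mul τ (_ * _) (Prod.fst _)]
  exact h.comp measurable_swap

variable [IsTopologicalGroup G] [CompactSpace G] (μ : Measure G) [μ.IsHaarMeasure]
  [IsProbabilityMeasure μ]

theorem integral_sq_re_character (hτ : IsContinuousRep τ) (hirr : τ.IsIrreducible)
    (hreal : ∀ g : G, (τ.character g).im = 0) : ∫ g, (τ.character g).re ^ 2 ∂μ = 1 := by
  have hnorm := integral_character_inv_mul_character μ hτ hτ
  rw [Representation.IsIrreducible.finrank_intertwiningMap_self, Nat.cast_one] at hnorm
  rw [← Complex.ofReal_inj, ← integral_complex_ofReal, Complex.ofReal_one, ← hnorm]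
  refine integral_congr_ae (.of_forall fun g => ?_)
  simp only [Complex.ofReal_pow, ofReal_re_character hreal, hτ.character_inv,
    Complex.conj_eq_iff_im.2 (hreal g), ← sq]

theorem integral_re_character_conj_mul (hτ : IsContinuousRep τ) (hirr : τ.IsIrreducible)
    (hreal : ∀ g : G, (τ.character g).im = 0) (α g : G) :
    ∫ h, (τ.character (h * α * h⁻¹ * g)).re ∂μ =
      (τ.character α).re / Module.finrank ℂ V * (τ.character g).re := by
  rw [← Complex.ofReal_inj, ← integral_complex_ofReal]
  simp only [Complex.ofReal_mul, Complex.ofReal_div, Complex.ofReal_natCast,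
    ofReal_re_character hreal]
  exact integral_character_conj_mul μ hτ hirr α g

end RealCharacter

end CompactLieCLT

end

open CompactLieCLT in
theorem theorem3_general
    {G V : Type*} [Group G] [TopologicalSpace G] [IsTopologicalGroup G] [CompactSpace G]
    [MeasurableSpace G] [BorelSpace G]
    (μ : Measure G) [μ.IsHaarMeasure] [IsProbabilityMeasure μ]
    [AddCommGroup V] [Module ℂ V] [FiniteDimensional ℂ V]
    (τ : Representation ℂ G V) (hτ : IsContinuousRep τ) (hirr : τ.IsIrreducible)
    (hreal : ∀ g : G, (τ.character g).im = 0)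
    (α : G) (hconj : IsConj α α⁻¹)
    (a : ℝ) (ha : a = 1 - (τ.character α).re / (Module.finrank ℂ V : ℝ)) (ha0 : a ≠ 0) :
    (∀ φ : IrrepClass G, (φ.character α).im = 0) ∧
    {φ : IrrepClass G | φ.mult (τ.tprod τ) ≠ 0}.Finite ∧
    0 ≤ ∑ᶠ φ : IrrepClass G, (φ.mult (τ.tprod τ) : ℝ) ^ 2 *
          (8 - 6 / a * (1 - (φ.character α).re / (φ.dim : ℝ))) ∧
    ∀ x₀ : ℝ,
      |μ.real {g : G | (τ.character g).re ≤ x₀} -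
          1 / √(2 * Real.pi) * ∫ x in Iic x₀, Real.exp (-x ^ 2 / 2)| ≤
        √(∑ᶠ (φ : IrrepClass G) (_ : ¬ φ.IsTrivial), (φ.mult (τ.tprod τ) : ℝ) ^ 2 *
            (2 - 1 / a * (1 - (φ.character α).re / (φ.dim : ℝ))) ^ 2) +
        (1 / Real.pi * ∑ᶠ φ : IrrepClass G, (φ.mult (τ.tprod τ) : ℝ) ^ 2 *
            (8 - 6 / a * (1 - (φ.character α).re / (φ.dim : ℝ)))) ^ (1 / 4 : ℝ) := by
  have hmean (g : G) : ∫ h, (τ.character (h * α * h⁻¹ * g)).re ∂μ =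
      (1 - a) * (τ.character g).re := by
    rw [ha, sub_sub_cancel, integral_re_character_conj_mul μ hτ hirr hreal]
  have hw : Continuous fun g => (τ.character g).re :=
    Complex.continuous_re.comp hτ.continuous_character
  have hwα : Measurable fun p : G × G => (τ.character (p.2 * α * p.2⁻¹ * p.1)).re :=
    Complex.measurable_re.comp (hτ.measurable_character_conj_mul α)
  have hvar := integral_sq_re_character μ hτ hirr hreal
  obtain ⟨r, hmult, hr⟩ := exists_hasCharacterExpansion_sq_re_character hτ hreal
  simp only [← hmult, ← measureReal_gaussianReal_std_Iic]
  exact ⟨fun φ => φ.character_im_eq_zero hconj,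
    r.hasFiniteSupport.subset fun φ hφ => by simpa [hmult] using hφ,
    finsum_sq_mul_characterRatio_nonneg hw hwα hconj hmean hr hvar ha0,
    abs_measureReal_le_sub_gaussianReal_std_le_of_hasCharacterExpansion hw hwα hconj hmean hr hvar
      ha0⟩

open CompactLieCLT in
theorem theorem3
    {E H G V : Type*}
    -- `G` is a compact Lie group
    [NormedAddCommGroup E] [NormedSpace ℝ E] [FiniteDimensional ℝ E] [TopologicalSpace H]
    (I : ModelWithCorners ℝ E H) [I.Boundaryless]
    [Group G] [TopologicalSpace G] [ChartedSpace H G] [LieGroup I ∞ G]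
    [CompactSpace G] [T2Space G]
    -- `μ` is its normalized Haar measure
    [MeasurableSpace G] [BorelSpace G]
    (μ : Measure G) [μ.IsHaarMeasure] [IsProbabilityMeasure μ]
    -- `τ` is a nontrivial irreducible representation with real-valued character
    [AddCommGroup V] [Module ℂ V] [FiniteDimensional ℂ V]
    (τ : Representation ℂ G V) (hτ : IsContinuousRep τ) (hirr : τ.IsIrreducible)
    (hnontriv : ¬ τ.IsTrivial) (hreal : ∀ g : G, (τ.character g).im = 0)
    -- `α ≠ 1` is conjugate to its inverse
    (α : G) (hα : α ≠ 1) (hconj : IsConj α α⁻¹)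
    -- `a = 1 - χ^τ(α) / dim τ`, by which the bound divides
    (a : ℝ) (ha : a = 1 - (τ.character α).re / (Module.finrank ℂ V : ℝ)) (ha0 : a ≠ 0) :
    -- the quantities in the bound make sense: the `χ^φ(α)` are real, the sums are finite,
    -- and the fourth root is taken of a nonnegative number
    (∀ φ : IrrepClass G, (φ.character α).im = 0) ∧
    {φ : IrrepClass G | φ.mult (τ.tprod τ) ≠ 0}.Finite ∧
    0 ≤ ∑ᶠ φ : IrrepClass G, (φ.mult (τ.tprod τ) : ℝ) ^ 2 *
          (8 - 6 / a * (1 - (φ.character α).re / (φ.dim : ℝ))) ∧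
    -- the bound
    ∀ x₀ : ℝ,
      |μ.real {g : G | (τ.character g).re ≤ x₀} -
          1 / √(2 * Real.pi) * ∫ x in Iic x₀, Real.exp (-x ^ 2 / 2)| ≤
        √(∑ᶠ (φ : IrrepClass G) (_ : ¬ φ.IsTrivial), (φ.mult (τ.tprod τ) : ℝ) ^ 2 *
            (2 - 1 / a * (1 - (φ.character α).re / (φ.dim : ℝ))) ^ 2) +
        (1 / Real.pi * ∑ᶠ φ : IrrepClass G, (φ.mult (τ.tprod τ) : ℝ) ^ 2 *
            (8 - 6 / a * (1 - (φ.character α).re / (φ.dim : ℝ)))) ^ (1 / 4 : ℝ) := by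
  have : IsTopologicalGroup G := topologicalGroup_of_lieGroup I ∞
  exact theorem3_general μ τ hτ hirr hreal α hconj a ha ha0
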